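/- Let $T\ge 1$, $n_1,\dots,n_T\ge 0$ and $p$ be integers, $\bar n=\sum_{t=1}^T n_t$, and assume $p\ge \bar n+2$. Let $w_1^*,\dots,w_T^*\in\mathbb{R}^p$ be fixed vectors and $\sigma\in\mathbb{R}$. For $1\le t\le T$ and $1\le i\le n_t$ let $x_{t,i}\sim\mathcal N(0,I_p)$ and $z_{t,i}\sim\mathcal N(0,\sigma^2)$ be mutually independent, and let $y_{t,i}=x_{t,i}^\top w_t^*+z_{t,i}$. The multi-task learner $w_{1:T}$ is the vector $w\in\mathbb{R}^p$ of minimum Euclidean norm satisfying $x_{t,i}^\top w=y_{t,i}$ for all $t$ and all $i\le n_t$. The single-task learner $w_t$ is the vector $w\in\mathbb{R}^p$ of minimum Euclidean norm satisfying $x_{t,i}^\top w=y_{t,i}$ for all $i\le n_t$. Almost surely, each of these vectors exists and is unique. Let $\mathcal L_t(w)=\|w-w_t^*\|_2^2$ and define the average generalization error and the average knowledge transfer by $$G(w_{1:T})=\frac1T\sum_{t=1}^T\mathcal L_t(w_{1:T}),\qquad K(w_{1:T})=\frac1T\sum_{t=1}^T\big[\mathcal L_t(w_t)-\mathcal L_t(w_{1:T})\big].$$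 Both are integrable, and $$\mathbb E[G(w_{1:T})]=\underbrace{\sum_{t=1}^T\sum_{t'=1}^T\frac{n_{t'}}{Tp}\Big(1+\frac{T n_t}{2(p-\bar n-1)}\Big)\|w_t^*-w_{t'}^*\|_2^2}_{G_1}+\underbrace{\frac1T\Big(1-\frac{\bar n}{p}\Big)\sum_{t=1}^T\|w_t^*\|_2^2}_{G_2}+\underbrace{\frac{\bar n\sigma^2}{p-\bar n-1}}_{G_3},$$ $$\mathbb E[K(w_{1:T})]=\underbrace{2\sum_{t=1}^T\sum_{t'=1}^T\frac{n_{t'}}{Tp}\Big(1+\frac{T n_t}{2(p-\bar n-1)}\Big)\langle w_t^*,w_{t'}^*\rangle}_{K_1}-\underbrace{\Big(1+\frac1T+\frac{\bar n}{p-\bar n-1}\Big)\sum_{t=1}^T\frac{n_t}{p}\|w_t^*\|_2^2}_{K_2}-\underbrace{\Big(\frac{\bar n\sigma^2}{p-\bar n-1}-\frac1T\sum_{t=1}^T\frac{n_t\sigma^2}{p-n_t-1}\Big)}_{K_3}.$$ -/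

import Mathlib

open MeasureTheory ProbabilityTheory

namespace MultiTask

/-- Parameter space `ℝ^p` with the Euclidean norm. -/
abbrev Param (p : ℕ) : Type := EuclideanSpace ℝ (Fin p)

section Learner

variable {p : ℕ} {ι : Type*}

/-- The parameter vectors `w` that fit the data exactly: `x_iᵀ w = y_i` for every sample `i`
(in matrix form, `Xᵀ w = y`, the `x_i` being the columns of `X`). -/
def interpolators (x : ι → Param p) (y : ι → ℝ) : Set (Param p) :=
  {w | ∀ i, inner ℝ (x i) w = y i}

/-- `w` solves `min ‖w‖²` subject to `x_iᵀ w = y_i` for every `i`. -/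
def IsMinNormInterpolator (x : ι → Param p) (y : ι → ℝ) (w : Param p) : Prop :=
  w ∈ interpolators x y ∧ IsMinOn (fun v : Param p => ‖v‖ ^ 2) (interpolators x y) w

open Classical in
/-- The minimum-norm interpolator of a data set (`0` if the data cannot be interpolated). -/
noncomputable def minNormInterpolator (x : ι → Param p) (y : ι → ℝ) : Param p :=
  if h : ∃ w, IsMinNormInterpolator x y w then h.choose else 0

end Learner

section Tasks

variable {T p : ℕ} {n : Fin T → ℕ}

/-- Indices of all training samples: pairs of a task `t` and one of its `n t` samples. -/
abbrev SampleIdx (n : Fin T → ℕ) : Type := (t : Fin T) × Fin (n t)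

/-- The labels `y_{t,i} = x_{t,i}ᵀ w_t^* + z_{t,i}`. -/
noncomputable def labels (wstar : Fin T → Param p) (x : SampleIdx n → Param p)
    (z : SampleIdx n → ℝ) : SampleIdx n → ℝ :=
  fun s => inner ℝ (x s) (wstar s.1) + z s

/-- The multi-task learner `w_{1:T}`, trained on the samples of all tasks. -/
noncomputable def multiTaskLearner (wstar : Fin T → Param p) (x : SampleIdx n → Param p)
    (z : SampleIdx n → ℝ) : Param p :=
  minNormInterpolator x (labels wstar x z)

/-- The single-task learner `w_t`, trained on the samples of task `t` only. -/
noncomputable def singleTaskLearner (wstar : Fin T → Param p) (x : SampleIdx n → Param p)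
    (z : SampleIdx n → ℝ) (t : Fin T) : Param p :=
  minNormInterpolator (fun i : Fin (n t) => x ⟨t, i⟩) (fun i => labels wstar x z ⟨t, i⟩)

/-- Generalization error of `w` on task `t` (the test loss without the irreducible `σ²`). -/
noncomputable def taskLoss (wstar : Fin T → Param p) (t : Fin T) (w : Param p) : ℝ :=
  ‖w - wstar t‖ ^ 2

/-- Average generalization error `G(w_{1:T})`, for given features and noise. -/
noncomputable def avgGenError (wstar : Fin T → Param p) (x : SampleIdx n → Param p)
    (z : SampleIdx n → ℝ) : ℝ :=
  (1 / (T : ℝ)) * ∑ t, taskLoss wstar t (multiTaskLearner wstar x z)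

/-- Average knowledge transfer `K(w_{1:T})`, for given features and noise. -/
noncomputable def avgTransfer (wstar : Fin T → Param p) (x : SampleIdx n → Param p)
    (z : SampleIdx n → ℝ) : ℝ :=
  (1 / (T : ℝ)) * ∑ t, (taskLoss wstar t (singleTaskLearner wstar x z t)
    - taskLoss wstar t (multiTaskLearner wstar x z))

end Tasks

/-- The data model: features with law `N(0, I_p)` and noise with law `N(0, σ²)`, all of these
random variables being mutually independent. -/
structure IsGaussianData {Ω ι : Type*} [MeasurableSpace Ω] (μ : Measure Ω) {p : ℕ} (σ : ℝ)
    (x : ι → Ω → Param p) (z : ι → Ω → ℝ) : Prop where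
  feature_law : ∀ i, HasLaw (x i) (stdGaussian (Param p)) μ
  noise_law : ∀ i, HasLaw (z i) (gaussianReal 0 ⟨σ ^ 2, sq_nonneg σ⟩) μ
  feature_indep : iIndepFun x μ
  noise_indep : iIndepFun z μ
  feature_noise_indep : IndepFun (fun ω i => x i ω) (fun ω i => z i ω) μ

end MultiTask

/-! Write N for the number of samples, G for the Gram matrix of the features, and g_st for the
entries of G⁻¹. Almost surely the features are linearly independent, and the minimum-norm
interpolator is then Σ y_s d_s, where d_s is the dual family, with ⟨d_s, d_t⟩ = g_st. Splitting the
label y_s = ⟨x_s, w⟩ + a_s around a target w makes the error the sum of two orthogonal pieces: its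
square is Σ g_st a_s a_t + ‖w‖² - ‖Pw‖², with P the projection onto the span of the features. The
residual a_s = ⟨x_s, w*_s - w⟩ + z_s collects task mismatch and noise.

Everything thus reduces to the expectations of g_st and of g_st ⟨x_s, u⟩ ⟨x_t, v⟩. The second is a
rotation-invariant bilinear form in (u, v), hence a multiple of ⟨u, v⟩, and its trace is E[g_st
⟨x_s, x_t⟩]. For s = t, g_ss is the inverse squared distance from x_s to the span of the other N - 1
vectors; conditionally on these, the moment is an inverse chi-square moment in dimension p - N + 1,
namely 1/(p - N - 1). For s ≠ t, exchangeability and the row identity Σ_j g_sj ⟨x_j, x_s⟩ = 1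
determine the value (`integral_invGram_mul_inner_pair`).

`integral_loss` assembles these moments for one target. Averaging over tasks gives the error; the
transfer follows by subtracting it from the single-task losses, where the mismatch vanishes. -/

namespace MultiTask

/-! ### Inverse moments and orthogonal projections of a standard Gaussian vector. -/

section StdGaussian

open Filter Topology

/-- Stated in `ENNReal` so that a = 0 is included, both sides being infinite: 1/‖y‖² can then be
replaced by its Laplace integral at every y, without first excluding y = 0. -/
theorem lintegral_exp_neg_mul_Ioi {a : ℝ} (ha : 0 ≤ a) :
    ∫⁻ t in Set.Ioi (0 : ℝ), ENNReal.ofReal (Real.exp (-a * t)) = (ENNReal.ofReal a)⁻¹ := by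
  rcases ha.eq_or_lt with rfl | ha
  · simp
  · rw [← ofReal_integral_eq_lintegral_ofReal (integrableOn_exp_mul_Ioi (by linarith) 0)
      (ae_of_all _ fun _ => (Real.exp_pos _).le), integral_exp_mul_Ioi (by linarith),
      ← ENNReal.ofReal_inv_of_pos ha]
    congr 1
    simp [neg_div_neg_eq]

theorem integral_exp_neg_mul_sq_gaussianReal {t : ℝ} (ht : 0 < t) :
    ∫ x, Real.exp (-t * x ^ 2) ∂gaussianReal 0 1 = (1 + 2 * t) ^ (-(1 / 2) : ℝ) := by
  rw [integral_gaussianReal_eq_integral_smul one_ne_zero]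
  simp only [gaussianPDFReal, NNReal.coe_one, mul_one, sub_zero, smul_eq_mul, mul_assoc]
  rw [integral_const_mul]
  have h : ∀ x : ℝ, Real.exp (-x ^ 2 / 2) * Real.exp (-t * x ^ 2)
      = Real.exp (-(t + 1 / 2) * x ^ 2) := fun x => by
    rw [← Real.exp_add]; ring_nf
  simp_rw [h]
  rw [integral_gaussian, ← Real.sqrt_inv, ← Real.sqrt_mul (by positivity), Real.rpow_neg (by positivity),
    ← Real.sqrt_eq_rpow, ← Real.sqrt_inv]
  congr 1
  have := Real.pi_ne_zero
  field_simp
  ring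

variable {F : Type*} [NormedAddCommGroup F] [InnerProductSpace ℝ F] [FiniteDimensional ℝ F]
  [MeasurableSpace F] [BorelSpace F]

theorem integral_exp_neg_mul_normSq_stdGaussian {t : ℝ} (ht : 0 < t) :
    ∫ y, Real.exp (-t * ‖y‖ ^ 2) ∂stdGaussian F
      = (1 + 2 * t) ^ (-(Module.finrank ℝ F / 2) : ℝ) := by
  rw [stdGaussian_eq_map_pi_orthonormalBasis (stdOrthonormalBasis ℝ F),
    integral_map (Measurable.aemeasurable (by fun_prop))
      (Measurable.aestronglyMeasurable (by fun_prop))]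
  have h : ∀ x : Fin (Module.finrank ℝ F) → ℝ,
      Real.exp (-t * ‖∑ i, x i • stdOrthonormalBasis ℝ F i‖ ^ 2)
        = ∏ i, Real.exp (-t * x i ^ 2) := fun x => by
    rw [← Real.exp_sum, ← Finset.mul_sum, ← (stdOrthonormalBasis ℝ F).sum_sq_inner_right]
    simp [(stdOrthonormalBasis ℝ F).orthonormal.inner_right_fintype]
  simp_rw [h]
  rw [integral_fintype_prod_eq_pow (fun x : ℝ => Real.exp (-t * x ^ 2)),
    integral_exp_neg_mul_sq_gaussianReal ht, ← Real.rpow_natCast, ← Real.rpow_mul (by positivity)]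
  congr 1
  simp only [Fintype.card_fin]
  ring

theorem integrableOn_and_integral_rpow_one_add_two_mul_Ioi {k : ℝ} (hk : 2 < k) :
    IntegrableOn (fun t : ℝ => (1 + 2 * t) ^ (-(k / 2))) (Set.Ioi 0) ∧
    ∫ t in Set.Ioi (0 : ℝ), (1 + 2 * t) ^ (-(k / 2)) = 1 / (k - 2) := by
  have hd : ∀ t ∈ Set.Ici (0 : ℝ), HasDerivAt (fun t : ℝ => -(1 + 2 * t) ^ (-(k / 2) + 1) / (k - 2))
      ((1 + 2 * t) ^ (-(k / 2))) t := by
    intro t ht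
    have ht : 0 ≤ t := ht
    have h1 : HasDerivAt (fun t : ℝ => 1 + 2 * t) (2 * 1) t :=
      ((hasDerivAt_id t).const_mul 2).const_add 1
    convert! ((h1.rpow_const (p := -(k / 2) + 1) (Or.inl (by positivity))).neg).div_const (k - 2) using 1
    have : k - 2 ≠ 0 := by linarith
    field_simp
    simp only [add_sub_cancel_right, neg_div]
    ring
  have hlim : Tendsto (fun t : ℝ => -(1 + 2 * t) ^ (-(k / 2) + 1) / (k - 2)) atTop (𝓝 0) := by
    have h2 : Tendsto (fun t : ℝ => 1 + 2 * t) atTop atTop :=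
      tendsto_atTop_add_const_left _ _ (tendsto_id.const_mul_atTop two_pos)
    have h3 := ((tendsto_rpow_neg_atTop (y := k / 2 - 1) (by linarith)).comp h2).neg.div_const (k - 2)
    simpa [Function.comp_def, show -(k / 2 - 1) = -(k / 2) + 1 by ring] using h3
  have hnn : ∀ t ∈ Set.Ioi (0 : ℝ), 0 ≤ (1 + 2 * t) ^ (-(k / 2)) := fun t ht => by
    have ht : 0 < t := ht
    positivity
  refine ⟨integrableOn_Ioi_deriv_of_nonneg' hd hnn hlim, ?_⟩
  rw [integral_Ioi_of_hasDerivAt_of_nonneg' hd hnn hlim]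
  simp [neg_div]

/-- With 1/‖y‖² = ∫ exp(-t‖y‖²) dt over t > 0, Tonelli reduces the moment to the integral of the
Laplace transform (1 + 2t)^(-k/2) of ‖y‖², which converges exactly when k > 2. -/
theorem lintegral_inv_normSq_stdGaussian (hF : 2 < Module.finrank ℝ F) :
    ∫⁻ y, (ENNReal.ofReal (‖y‖ ^ 2))⁻¹ ∂stdGaussian F
      = ENNReal.ofReal (1 / (Module.finrank ℝ F - 2)) := by
  have hk : (2 : ℝ) < Module.finrank ℝ F := by exact_mod_cast hF
  obtain ⟨hint, hval⟩ := integrableOn_and_integral_rpow_one_add_two_mul_Ioi hk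
  simp_rw [← lintegral_exp_neg_mul_Ioi (sq_nonneg ‖_‖)]
  rw [lintegral_lintegral_swap (Measurable.aemeasurable (by fun_prop)), ← hval,
    ofReal_integral_eq_lintegral_ofReal hint]
  · refine setLIntegral_congr_fun measurableSet_Ioi fun t ht => ?_
    have ht : 0 < t := ht
    rw [← integral_exp_neg_mul_normSq_stdGaussian ht, ofReal_integral_eq_lintegral_ofReal]
    · refine lintegral_congr fun y => ?_
      ring_nf
    · refine Integrable.of_bound (Measurable.aestronglyMeasurable (by fun_prop)) 1
        (ae_of_all _ fun y => ?_)
      rw [Real.norm_eq_abs, Real.abs_exp, Real.exp_le_one_iff]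
      nlinarith [sq_nonneg ‖y‖]
    · exact ae_of_all _ fun _ => (Real.exp_pos _).le
  · filter_upwards [ae_restrict_mem measurableSet_Ioi] with t ht
    have ht : 0 < t := ht
    show 0 ≤ _
    positivity

/-- A finite inverse moment forces the integrand to be finite almost everywhere. -/
theorem ae_ne_zero_stdGaussian (hF : 2 < Module.finrank ℝ F) : ∀ᵐ y ∂stdGaussian F, y ≠ 0 := by
  have h := ae_lt_top (μ := stdGaussian F) (f := fun y => (ENNReal.ofReal (‖y‖ ^ 2))⁻¹) (by fun_prop)
    (by rw [lintegral_inv_normSq_stdGaussian hF]; exact ENNReal.ofReal_ne_top)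
  filter_upwards [h] with y hy h0
  simp [h0] at hy

theorem integrable_inv_normSq_stdGaussian (hF : 2 < Module.finrank ℝ F) :
    Integrable (fun y => (‖y‖ ^ 2)⁻¹) (stdGaussian F) ∧
      ∫ y, (‖y‖ ^ 2)⁻¹ ∂stdGaussian F = 1 / (Module.finrank ℝ F - 2) := by
  have hk : (2 : ℝ) < Module.finrank ℝ F := by exact_mod_cast hF
  have h : ∫⁻ y, ENNReal.ofReal ((‖y‖ ^ 2)⁻¹) ∂stdGaussian F
      = ENNReal.ofReal (1 / (Module.finrank ℝ F - 2)) := by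
    rw [← lintegral_inv_normSq_stdGaussian hF]
    refine lintegral_congr_ae ?_
    filter_upwards [ae_ne_zero_stdGaussian hF] with y hy
    rw [ENNReal.ofReal_inv_of_pos (by positivity)]
  have hm : AEStronglyMeasurable (fun y : F => (‖y‖ ^ 2)⁻¹) (stdGaussian F) :=
    Measurable.aestronglyMeasurable (by fun_prop)
  have h0 : 0 ≤ᵐ[stdGaussian F] fun y : F => (‖y‖ ^ 2)⁻¹ := ae_of_all _ fun y => by positivity
  refine ⟨(lintegral_ofReal_ne_top_iff_integrable hm h0).1 (by simp [h]), ?_⟩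
  rw [integral_eq_lintegral_of_nonneg_ae h0 hm, h, ENNReal.toReal_ofReal]
  exact one_div_nonneg.2 (by linarith)

theorem integrable_normSq_stdGaussian :
    Integrable (fun y => ‖y‖ ^ 2) (stdGaussian F) := by
  simpa using (IsGaussian.memLp_two_id (μ := stdGaussian F)).integrable_norm_pow (by simp)

theorem integral_normSq_stdGaussian :
    ∫ y, ‖y‖ ^ 2 ∂stdGaussian F = Module.finrank ℝ F := by
  have hL : MemLp id 2 (stdGaussian F) := IsGaussian.memLp_two_id
  have hi : ∀ i, ∫ y, inner ℝ (stdOrthonormalBasis ℝ F i) y ^ 2 ∂stdGaussian F = 1 := fun i => by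
    have h := variance_dual_stdGaussian (innerSL ℝ (stdOrthonormalBasis ℝ F i))
    rw [variance_of_integral_eq_zero (by fun_prop) (integral_strongDual_stdGaussian _)] at h
    simpa using h
  simp_rw [← (stdOrthonormalBasis ℝ F).sum_sq_inner_right]
  rw [integral_finsetSum]
  · simp [hi]
  · intro i _
    exact ((innerSL ℝ (stdOrthonormalBasis ℝ F i)).comp_memLp' hL).integrable_sq

/-- The two projections are independent standard Gaussians: by Pythagoras the characteristic
function exp(-‖t‖²/2) factors over K × Kᗮ, and the orthogonal decomposition is an isometry. -/
theorem measurePreserving_orthogonalProjection_prod (K : Submodule ℝ F) :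
    MeasurePreserving (fun y => (K.orthogonalProjectionOnto y, Kᗮ.orthogonalProjectionOnto y))
      (stdGaussian F) ((stdGaussian K).prod (stdGaussian Kᗮ)) := by
  refine ⟨by fun_prop, ?_⟩
  have h1 : ((stdGaussian K).prod (stdGaussian Kᗮ)).map (WithLp.toLp 2)
      = stdGaussian (WithLp 2 (K × Kᗮ)) := by
    apply Measure.ext_of_charFun
    ext t
    rw [charFun_prod, charFun_stdGaussian, charFun_stdGaussian, charFun_stdGaussian,
      ← Complex.exp_add, ← Complex.ofReal_pow ‖t‖, WithLp.prod_norm_sq_eq_of_L2]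
    congr 1
    push_cast
    simp only [WithLp.ofLp_fst, WithLp.ofLp_snd]
    ring
  rw [← stdGaussian_map K.orthogonalDecomposition] at h1
  have h2 := congrArg (Measure.map (WithLp.ofLp)) h1
  rw [Measure.map_map (by fun_prop) (by fun_prop), Measure.map_map (by fun_prop) (by fun_prop)] at h2
  symm
  simpa [Function.comp_def, Submodule.orthogonalDecomposition_apply] using h2

theorem ae_orthogonalProjection_ne_zero (K : Submodule ℝ F)
    (hK : Module.finrank ℝ K + 2 < Module.finrank ℝ F) :
    ∀ᵐ y ∂stdGaussian F, Kᗮ.orthogonalProjectionOnto y ≠ 0 := by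
  have hdim := K.finrank_add_finrank_orthogonal
  have hmp := measurePreserving_snd.comp (measurePreserving_orthogonalProjection_prod K)
  exact hmp.quasiMeasurePreserving.ae (ae_ne_zero_stdGaussian (F := Kᗮ) (by omega))

theorem integral_inv_normSq_orthogonalProjection (K : Submodule ℝ F)
    (hK : Module.finrank ℝ K + 2 < Module.finrank ℝ F) :
    Integrable (fun y => (‖Kᗮ.orthogonalProjectionOnto y‖ ^ 2)⁻¹) (stdGaussian F) ∧
      ∫ y, (‖Kᗮ.orthogonalProjectionOnto y‖ ^ 2)⁻¹ ∂stdGaussian F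
        = 1 / (Module.finrank ℝ F - Module.finrank ℝ K - 2) := by
  have hdim := K.finrank_add_finrank_orthogonal
  have hmp := measurePreserving_snd.comp (measurePreserving_orthogonalProjection_prod K)
  obtain ⟨hi, hv⟩ := integrable_inv_normSq_stdGaussian (F := Kᗮ) (by omega)
  refine ⟨hmp.integrable_comp_of_integrable hi, ?_⟩
  have h := integral_map (μ := stdGaussian F) hmp.measurable.aemeasurable
    (f := fun y : Kᗮ => (‖y‖ ^ 2)⁻¹) (Measurable.aestronglyMeasurable (by fun_prop))
  rw [hmp.map_eq, hv] at h
  refine h.symm.trans ?_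
  rw [← hdim]
  push_cast
  ring_nf

theorem integral_normSq_div_normSq_orthogonalProjection (K : Submodule ℝ F)
    (hK : Module.finrank ℝ K + 2 < Module.finrank ℝ F) :
    Integrable (fun y => (‖Kᗮ.orthogonalProjectionOnto y‖ ^ 2)⁻¹ * ‖y‖ ^ 2) (stdGaussian F) ∧
      ∫ y, (‖Kᗮ.orthogonalProjectionOnto y‖ ^ 2)⁻¹ * ‖y‖ ^ 2 ∂stdGaussian F
        = (Module.finrank ℝ F - 2) / (Module.finrank ℝ F - Module.finrank ℝ K - 2) := by
  have hdim := K.finrank_add_finrank_orthogonal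
  have hk : (Module.finrank ℝ K : ℝ) + 2 < Module.finrank ℝ F := by exact_mod_cast hK
  have hmp := measurePreserving_orthogonalProjection_prod K
  obtain ⟨hi, hv⟩ := integrable_inv_normSq_stdGaussian (F := Kᗮ) (by omega)
  have hprod : Integrable (fun q : K × Kᗮ => ‖q.1‖ ^ 2 * (‖q.2‖ ^ 2)⁻¹)
      ((stdGaussian K).prod (stdGaussian Kᗮ)) :=
    (integrable_normSq_stdGaussian (F := K)).mul_prod hi
  have hval : ∫ q : K × Kᗮ, ‖q.1‖ ^ 2 * (‖q.2‖ ^ 2)⁻¹ ∂((stdGaussian K).prod (stdGaussian Kᗮ))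
      = Module.finrank ℝ K * (1 / (Module.finrank ℝ Kᗮ - 2)) := by
    rw [integral_prod_mul (fun a : K => ‖a‖ ^ 2) (fun b : Kᗮ => (‖b‖ ^ 2)⁻¹),
      integral_normSq_stdGaussian, hv]
  have hcomp : Integrable (fun y => ‖K.orthogonalProjectionOnto y‖ ^ 2 *
      (‖Kᗮ.orthogonalProjectionOnto y‖ ^ 2)⁻¹) (stdGaussian F) :=
    hmp.integrable_comp_of_integrable hprod
  -- By Pythagoras the ratio is 1 plus a quotient of independent variables, so its mean is k/(p - k
  -- - 2) + 1 with k = dim K and p = dim F.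
  have heq : (fun y => (‖Kᗮ.orthogonalProjectionOnto y‖ ^ 2)⁻¹ * ‖y‖ ^ 2) =ᵐ[stdGaussian F]
      fun y => ‖K.orthogonalProjectionOnto y‖ ^ 2 * (‖Kᗮ.orthogonalProjectionOnto y‖ ^ 2)⁻¹ + 1 := by
    filter_upwards [ae_orthogonalProjection_ne_zero K hK] with y hy
    have : ‖Kᗮ.orthogonalProjectionOnto y‖ ≠ 0 := norm_ne_zero_iff.2 hy
    rw [K.norm_sq_eq_add_norm_sq_projection y]
    field_simp
  refine ⟨(hcomp.add (integrable_const 1)).congr heq.symm, ?_⟩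
  rw [integral_congr_ae heq, integral_add hcomp (integrable_const 1)]
  have h := integral_map (μ := stdGaussian F) hmp.measurable.aemeasurable
    (f := fun q : K × Kᗮ => ‖q.1‖ ^ 2 * (‖q.2‖ ^ 2)⁻¹)
    (Measurable.aestronglyMeasurable (by fun_prop))
  rw [hmp.map_eq, hval] at h
  rw [← h, ← hdim]
  rw [← hdim] at hk
  push_cast at hk ⊢
  have h2 : (Module.finrank ℝ Kᗮ : ℝ) - 2 ≠ 0 := by linarith
  simp only [integral_const, probReal_univ, smul_eq_mul, mul_one, add_sub_cancel_left]
  field_simp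
  ring

end StdGaussian

/-! ### The inverse Gram matrix and the dual family. -/

section InverseGram

variable {ι F : Type*} [Fintype ι] [DecidableEq ι] [NormedAddCommGroup F] [InnerProductSpace ℝ F]

/-- The inverse of the Gram matrix of a family of vectors. -/
noncomputable def invGram (x : ι → F) : Matrix ι ι ℝ := (Matrix.gram ℝ x)⁻¹

/-- The dual family of a linearly independent family, inside its span. -/
noncomputable def dualFamily (x : ι → F) (s : ι) : F := ∑ j, invGram x s j • x j

theorem isUnit_det_gram {x : ι → F} (hx : LinearIndependent ℝ x) :
    IsUnit (Matrix.gram ℝ x).det :=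
  (Matrix.det_gram_ne_zero_iff_linearIndependent.2 hx).isUnit

theorem invGram_symm (x : ι → F) (s t : ι) : invGram x s t = invGram x t s := by
  have h : (Matrix.gram ℝ x).transpose = Matrix.gram ℝ x := by
    ext i j
    simp [real_inner_comm]
  have h2 : (invGram x).transpose = invGram x := by
    rw [invGram, Matrix.transpose_nonsing_inv, h]
  conv_lhs => rw [← h2]
  rfl

theorem sum_invGram_mul_inner {x : ι → F} (hx : LinearIndependent ℝ x) (s t : ι) :
    ∑ j, invGram x s j * inner ℝ (x j) (x t) = if s = t then 1 else 0 := by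
  have h := congrFun (congrFun (Matrix.nonsing_inv_mul _ (isUnit_det_gram hx)) s) t
  rwa [Matrix.mul_apply, Matrix.one_apply] at h

theorem inner_dualFamily {x : ι → F} (hx : LinearIndependent ℝ x) (s t : ι) :
    inner ℝ (dualFamily x s) (x t) = if s = t then (1 : ℝ) else 0 := by
  rw [← sum_invGram_mul_inner hx, dualFamily, sum_inner]
  simp [real_inner_smul_left]

theorem inner_dualFamily_dualFamily {x : ι → F} (hx : LinearIndependent ℝ x) (s t : ι) :
    inner ℝ (dualFamily x s) (dualFamily x t) = invGram x s t := by
  conv_lhs => rw [dualFamily.eq_1 x t, inner_sum]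
  simp [real_inner_smul_right, inner_dualFamily hx, invGram_symm x t s]

theorem inner_dualFamily_eq_sum (x : ι → F) (s : ι) (v : F) :
    inner ℝ (dualFamily x s) v = ∑ j, invGram x s j * inner ℝ (x j) v := by
  rw [dualFamily, sum_inner]
  simp [real_inner_smul_left]

theorem invGram_self_nonneg (x : ι → F) (s : ι) : 0 ≤ invGram x s s := by
  have h := (Matrix.posSemidef_gram ℝ x).inv.diag_nonneg (i := s)
  exact h

/-- Cauchy–Schwarz for the dual vectors followed by AM–GM. It dominates off-diagonal terms by
diagonal ones, so integrability needs checking only on the diagonal. -/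
theorem abs_invGram_mul_le {x : ι → F} (hx : LinearIndependent ℝ x) (s t : ι) (a b : ℝ) :
    |invGram x s t * a * b| ≤ invGram x s s * a ^ 2 + invGram x t t * b ^ 2 := by
  have hs := inner_dualFamily_dualFamily hx s s
  have ht := inner_dualFamily_dualFamily hx t t
  rw [real_inner_self_eq_norm_sq] at hs ht
  have hst := abs_real_inner_le_norm (dualFamily x s) (dualFamily x t)
  rw [inner_dualFamily_dualFamily hx] at hst
  rw [← hs, ← ht, abs_mul, abs_mul, ← sq_abs a, ← sq_abs b]
  calc |invGram x s t| * |a| * |b|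
      ≤ ‖dualFamily x s‖ * ‖dualFamily x t‖ * |a| * |b| := by gcongr
    _ ≤ _ := by
      nlinarith [sq_nonneg (‖dualFamily x s‖ * |a| - ‖dualFamily x t‖ * |b|),
        sq_nonneg (‖dualFamily x s‖ * |a|), sq_nonneg (‖dualFamily x t‖ * |b|)]

/-- The dual vector d_s is orthogonal to K, and projecting its expansion onto Kᗮ kills every x_t
with t ≠ s. Hence d_s = g_ss · (projection of x_s), and ‖d_s‖² = g_ss yields g_ss² ‖proj x_s‖² =
g_ss with g_ss ≠ 0. -/
theorem invGram_self_eq_inv_normSq [FiniteDimensional ℝ F] {x : ι → F}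
    (hx : LinearIndependent ℝ x) (s : ι) (K : Submodule ℝ F)
    (hK : K = Submodule.span ℝ (x '' {s}ᶜ)) :
    invGram x s s = (‖Kᗮ.orthogonalProjectionOnto (x s)‖ ^ 2)⁻¹ := by
  have hmem : dualFamily x s ∈ Kᗮ := by
    rw [hK, Submodule.mem_orthogonal']
    intro u hu
    induction hu using Submodule.span_induction with
    | mem u hu =>
      obtain ⟨t, ht, rfl⟩ := hu
      rw [inner_dualFamily hx, if_neg (Ne.symm ht)]
    | zero => simp
    | add u v _ _ hu hv => rw [inner_add_right, hu, hv, add_zero]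
    | smul c u _ hu => rw [inner_smul_right, hu, mul_zero]
  have hproj : Kᗮ.orthogonalProjectionOnto (dualFamily x s)
      = invGram x s s • Kᗮ.orthogonalProjectionOnto (x s) := by
    rw [dualFamily, map_sum, Finset.sum_eq_single s]
    · simp
    · intro t _ ht
      have hxt : x t ∈ Kᗮᗮ := by
        refine K.le_orthogonal_orthogonal ?_
        rw [hK]
        exact Submodule.subset_span ⟨t, ht, rfl⟩
      rw [map_smul, Submodule.orthogonalProjectionOnto_eq_zero_iff.2 hxt, smul_zero]
    · simp
  have hn : ‖Kᗮ.orthogonalProjectionOnto (dualFamily x s)‖ ^ 2 = invGram x s s := by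
    rw [← inner_dualFamily_dualFamily hx, real_inner_self_eq_norm_sq]
    have := Submodule.orthogonalProjectionOnto_mem_subspace_eq_self (K := Kᗮ) ⟨_, hmem⟩
    rw [this]
    simp
  rw [hproj, norm_smul, mul_pow, Real.norm_eq_abs, sq_abs] at hn
  have h0 : invGram x s s ≠ 0 := by
    intro h0
    rw [← inner_dualFamily_dualFamily hx, inner_self_eq_zero] at h0
    have := inner_dualFamily hx s s
    rw [h0, inner_zero_left, if_pos rfl] at this
    exact zero_ne_one this
  refine eq_inv_of_mul_eq_one_left (mul_left_cancel₀ h0 ?_)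
  linarith

theorem invGram_comp_linearIsometryEquiv (x : ι → F) (O : F ≃ₗᵢ[ℝ] F) :
    invGram (fun s => O (x s)) = invGram x := by
  have h : Matrix.gram ℝ (fun s => O (x s)) = Matrix.gram ℝ x := by
    ext i j
    simp
  rw [invGram, h, invGram]

theorem invGram_comp_perm (x : ι → F) (e : ι ≃ ι) (s t : ι) :
    invGram (fun j => x (e j)) s t = invGram x (e s) (e t) := by
  have h : Matrix.gram ℝ (fun j => x (e j)) = (Matrix.gram ℝ x).submatrix e e := rfl
  rw [invGram, h, Matrix.inv_submatrix_equiv]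
  rfl

theorem measurable_invGram [MeasurableSpace F] [BorelSpace F] [SecondCountableTopology F] (s t : ι) :
    Measurable (fun x : ι → F => invGram x s t) := by
  have hg : Continuous fun x : ι → F => Matrix.gram ℝ x :=
    continuous_matrix fun i j => by
      simp only [Matrix.gram_apply]
      fun_prop
  simp only [invGram, Matrix.inv_def, Ring.inverse_eq_inv', Matrix.smul_apply, smul_eq_mul]
  exact hg.matrix_det.measurable.inv.mul (hg.matrix_adjugate.matrix_elem s t).measurable

end InverseGram

/-! ### Independent Gaussian vectors: linear independence and diagonal moments by resampling one
vector. -/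

section GaussianFamily

theorem measurableSet_linearIndepOn {ι F : Type*} [Finite ι] [NormedAddCommGroup F]
    [InnerProductSpace ℝ F] [FiniteDimensional ℝ F] [MeasurableSpace F] [BorelSpace F]
    (S : Finset ι) : MeasurableSet {x : ι → F | LinearIndepOn ℝ x (S : Set ι)} := by
  have h := (isOpen_setOfPred_linearIndependent (𝕜 := ℝ) (E := F) (ι := (S : Set ι))).measurableSet
  have hr : Measurable (fun (x : ι → F) (i : (S : Set ι)) => x i) := by fun_prop
  exact hr h

theorem finrank_span_image_le {ι F : Type*} [AddCommGroup F] [Module ℝ F]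
    (x : ι → F) (S : Finset ι) :
    Module.finrank ℝ (Submodule.span ℝ (x '' (S : Set ι))) ≤ S.card := by
  classical
  have h := finrank_span_finset_le_card (R := ℝ) (S.image x)
  rw [Finset.coe_image] at h
  exact h.trans Finset.card_image_le

variable {ι F : Type*} [Fintype ι] [DecidableEq ι] [NormedAddCommGroup F] [InnerProductSpace ℝ F]
  [FiniteDimensional ℝ F] [MeasurableSpace F] [BorelSpace F]

/-- Replacing one coordinate by an independent copy keeps the product law; this is how conditioning
on all the other coordinates is expressed. -/
theorem measurePreserving_update {X : Type*} [MeasurableSpace X] (γ : Measure X)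
    [IsProbabilityMeasure γ] (s : ι) :
    MeasurePreserving (fun q : (ι → X) × X => Function.update q.1 s q.2)
      ((Measure.pi fun _ : ι => γ).prod γ) (Measure.pi fun _ : ι => γ) := by
  have hm : Measurable (fun q : (ι → X) × X => Function.update q.1 s q.2) := by
    refine measurable_pi_lambda _ fun i => ?_
    by_cases hi : i = s
    · subst hi; simpa using measurable_snd
    · simp only [Function.update_of_ne hi]; fun_prop
  refine ⟨hm, (Measure.pi_eq fun A hA => ?_).symm⟩
  have hpre : (fun q : (ι → X) × X => Function.update q.1 s q.2) ⁻¹' (Set.univ.pi A)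
      = (Set.univ.pi (Function.update A s Set.univ)) ×ˢ A s := by
    ext q
    simp only [Set.mem_preimage, Set.mem_pi, Set.mem_univ, true_imp_iff, Set.mem_prod]
    constructor
    · refine fun h => ⟨fun i => ?_, by simpa using h s⟩
      by_cases hi : i = s
      · subst hi; simp
      · simpa [hi] using h i
    · rintro ⟨h, hs⟩ i
      by_cases hi : i = s
      · subst hi; simpa using hs
      · simpa [hi] using h i
  rw [Measure.map_apply hm (MeasurableSet.univ_pi hA), hpre, Measure.prod_prod, Measure.pi_pi,
    ← Finset.mul_prod_erase _ _ (Finset.mem_univ s), ← Finset.mul_prod_erase _ (fun i => γ (A i))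
      (Finset.mem_univ s)]
  rw [Function.update_self, measure_univ, one_mul, mul_comm]
  congr 1
  refine Finset.prod_congr rfl fun i hi => ?_
  rw [Function.update_of_ne (Finset.ne_of_mem_erase hi)]

/-- A fresh Gaussian vector almost surely has a nonzero component orthogonal to the span of the
earlier ones. The cardinality bound keeps the orthogonal complement of dimension above 2, as the
inverse-moment argument for nonvanishing requires. -/
theorem ae_linearIndepOn_stdGaussian (S : Finset ι) (hS : S.card + 1 < Module.finrank ℝ F) :
    ∀ᵐ x ∂(Measure.pi fun _ : ι => stdGaussian F), LinearIndepOn ℝ x (S : Set ι) := by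
  induction S using Finset.induction_on with
  | empty => simp
  | insert s S hs ih =>
    rw [Finset.card_insert_of_notMem hs] at hS
    have hmp := measurePreserving_update (stdGaussian F) s (ι := ι)
    rw [← hmp.map_eq, ae_map_iff hmp.measurable.aemeasurable (measurableSet_linearIndepOn _)]
    refine (Measure.ae_prod_iff_ae_ae
      (hmp.measurable (measurableSet_linearIndepOn (insert s S)))).2 ?_
    filter_upwards [ih (by omega)] with x hx
    have hK := finrank_span_image_le x S
    filter_upwards [ae_orthogonalProjection_ne_zero (Submodule.span ℝ (x '' (S : Set ι))) (by omega)]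
      with y hy
    have heq : Set.EqOn x (Function.update x s y) (S : Set ι) := fun i hi => by
      rw [Function.update_of_ne]
      rintro rfl
      exact hs hi
    rw [Finset.coe_insert]
    refine (hx.congr heq).insert ?_
    rw [Function.update_self, ← heq.image_eq]
    intro hmem
    exact hy (Submodule.orthogonalProjectionOnto_eq_zero_iff.2
      (Submodule.le_orthogonal_orthogonal _ hmem))

theorem ae_linearIndependent_stdGaussian (h : Fintype.card ι + 1 < Module.finrank ℝ F) :
    ∀ᵐ x ∂(Measure.pi fun _ : ι => stdGaussian F), LinearIndependent ℝ x := by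
  filter_upwards [ae_linearIndepOn_stdGaussian (Finset.univ : Finset ι) h] with x hx
  rwa [Finset.coe_univ, linearIndepOn_univ_iff] at hx

/-- Fubini when the conditional mean given the other coordinates is a constant; nonnegativity turns
that same constant into the integrability bound. -/
theorem integral_pi_of_integral_update {X : Type*} [MeasurableSpace X] {γ : Measure X}
    [IsProbabilityMeasure γ] (s : ι) {f : (ι → X) → ℝ} {c : ℝ} (hf : Measurable f)
    (hf0 : ∀ x, 0 ≤ f x)
    (h : ∀ᵐ x ∂(Measure.pi fun _ : ι => γ),
      Integrable (fun y => f (Function.update x s y)) γ ∧ ∫ y, f (Function.update x s y) ∂γ = c) :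
    Integrable f (Measure.pi fun _ : ι => γ) ∧ ∫ x, f x ∂(Measure.pi fun _ : ι => γ) = c := by
  have hmp := measurePreserving_update γ s (ι := ι)
  have hfm := hf.comp hmp.measurable
  have hint : Integrable (f ∘ fun q : (ι → X) × X => Function.update q.1 s q.2)
      ((Measure.pi fun _ : ι => γ).prod γ) := by
    rw [integrable_prod_iff hfm.aestronglyMeasurable]
    refine ⟨h.mono fun x hx => hx.1, (integrable_const c).congr ?_⟩
    filter_upwards [h] with x hx
    simp only [Function.comp_apply, Real.norm_of_nonneg (hf0 _)]
    exact hx.2.symm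
  refine ⟨(hmp.integrable_comp hf.aestronglyMeasurable).1 hint, ?_⟩
  rw [← hmp.map_eq, integral_map hmp.measurable.aemeasurable hf.aestronglyMeasurable,
    integral_prod (fun q : (ι → X) × X => f (Function.update q.1 s q.2)) hint,
    integral_congr_ae (h.mono fun x hx => hx.2)]
  simp

theorem ae_update_invGram_self (h : Fintype.card ι + 1 < Module.finrank ℝ F) (s : ι) :
    ∀ᵐ x ∂(Measure.pi fun _ : ι => stdGaussian F), ∃ K : Submodule ℝ F,
      Module.finrank ℝ K + 1 = Fintype.card ι ∧ ∀ᵐ y ∂stdGaussian F,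
        invGram (Function.update x s y) s s = (‖Kᗮ.orthogonalProjectionOnto y‖ ^ 2)⁻¹ := by
  have hmp := measurePreserving_update (stdGaussian F) s (ι := ι)
  have hli := ae_linearIndependent_stdGaussian (ι := ι) (F := F) h
  have hli2 := Measure.ae_ae_of_ae_prod (hmp.quasiMeasurePreserving.ae hli)
  filter_upwards [hli, hli2] with x hx hx2
  -- This span does not involve the coordinate s, so it stays fixed while that coordinate is
  -- resampled.
  refine ⟨Submodule.span ℝ (x '' {s}ᶜ), ?_, ?_⟩
  · have h1 := finrank_span_eq_card (hx.comp (Subtype.val : ({s}ᶜ : Set ι) → ι)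
      Subtype.val_injective)
    rw [Set.range_comp, Subtype.range_coe] at h1
    have := Fintype.card_pos_iff.2 ⟨s⟩
    simp only [h1, Fintype.card_compl_set, Fintype.card_unique]
    omega
  · filter_upwards [hx2] with y hy
    rw [invGram_self_eq_inv_normSq hy s _ rfl, Function.update_self]
    have heq : Function.update x s y '' {s}ᶜ = x '' {s}ᶜ :=
      Set.image_congr fun i hi => Function.update_of_ne hi _ _
    rw [heq]

theorem integral_invGram_self (h : Fintype.card ι + 1 < Module.finrank ℝ F) (s : ι) :
    Integrable (fun x => invGram x s s) (Measure.pi fun _ : ι => stdGaussian F) ∧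
      ∫ x, invGram x s s ∂(Measure.pi fun _ : ι => stdGaussian F)
        = 1 / (Module.finrank ℝ F - Fintype.card ι - 1) := by
  refine integral_pi_of_integral_update s (measurable_invGram s s)
    (fun x => invGram_self_nonneg x s) ?_
  filter_upwards [ae_update_invGram_self h s] with x ⟨K, hK, hx⟩
  -- Here dim K = N - 1, so the denominator p - dim K - 2 becomes p - N - 1.
  obtain ⟨hi, hv⟩ := integral_inv_normSq_orthogonalProjection K (by omega)
  refine ⟨hi.congr (hx.mono fun y hy => hy.symm), ?_⟩
  rw [integral_congr_ae hx, hv, ← hK]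
  push_cast
  ring_nf

theorem integral_invGram_self_mul_normSq (h : Fintype.card ι + 1 < Module.finrank ℝ F) (s : ι) :
    Integrable (fun x => invGram x s s * ‖x s‖ ^ 2) (Measure.pi fun _ : ι => stdGaussian F) ∧
      ∫ x, invGram x s s * ‖x s‖ ^ 2 ∂(Measure.pi fun _ : ι => stdGaussian F)
        = (Module.finrank ℝ F - 2) / (Module.finrank ℝ F - Fintype.card ι - 1) := by
  refine integral_pi_of_integral_update s ((measurable_invGram s s).mul (by fun_prop))
    (fun x => mul_nonneg (invGram_self_nonneg x s) (sq_nonneg _)) ?_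
  filter_upwards [ae_update_invGram_self h s] with x ⟨K, hK, hx⟩
  obtain ⟨hi, hv⟩ := integral_normSq_div_normSq_orthogonalProjection K (by omega)
  have hx' : (fun y => invGram (Function.update x s y) s s * ‖Function.update x s y s‖ ^ 2)
      =ᵐ[stdGaussian F] fun y => (‖Kᗮ.orthogonalProjectionOnto y‖ ^ 2)⁻¹ * ‖y‖ ^ 2 := by
    filter_upwards [hx] with y hy
    rw [hy, Function.update_self]
  refine ⟨hi.congr hx'.symm, ?_⟩
  rw [integral_congr_ae hx', hv, ← hK]
  push_cast
  ring_nf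

end GaussianFamily

/-! ### Second moments of the inverse Gram matrix by rotation invariance and exchangeability. -/

theorem apply_mul_finrank_eq_of_isometry_invariant {F κ : Type*} [NormedAddCommGroup F]
    [InnerProductSpace ℝ F] [FiniteDimensional ℝ F] [Fintype κ] (b : OrthonormalBasis κ ℝ F)
    (B : F →ₗ[ℝ] F →ₗ[ℝ] ℝ) (hB : ∀ (O : F ≃ₗᵢ[ℝ] F) u v, B (O u) (O v) = B u v) (u v : F) :
    B u v * Module.finrank ℝ F = inner ℝ u v * ∑ i, B (b i) (b i) := by
  -- The reflection in the hyperplane orthogonal to b_i negates b_i and fixes b_j.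
  have hoff : ∀ i j, i ≠ j → B (b i) (b j) = 0 := fun i j hij => by
    have h := hB (Submodule.reflection (ℝ ∙ b i)ᗮ) (b i) (b j)
    rw [Submodule.reflection_orthogonalComplement_singleton_eq_neg,
      Submodule.reflection_mem_subspace_eq_self
        (Submodule.mem_orthogonal_singleton_iff_inner_right.2 (b.orthonormal.2 hij)),
      map_neg, LinearMap.neg_apply] at h
    linarith
  -- The reflection in the hyperplane orthogonal to b_i - b_j sends b_i to b_j.
  have hdiag : ∀ i j, B (b i) (b i) = B (b j) (b j) := fun i j => by
    have h := hB (Submodule.reflection (ℝ ∙ (b i - b j))ᗮ) (b i) (b i)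
    rw [Submodule.reflection_sub (by simp)] at h
    exact h.symm
  have hconst : ∀ i, (Module.finrank ℝ F : ℝ) * B (b i) (b i) = ∑ j, B (b j) (b j) := fun i => by
    rw [Finset.sum_congr rfl fun j _ => hdiag j i, Finset.sum_const, nsmul_eq_mul,
      Finset.card_univ, Module.finrank_eq_card_basis b.toBasis]
  have hexp : B u v = ∑ i, inner ℝ (b i) u * inner ℝ (b i) v * B (b i) (b i) := by
    conv_lhs => rw [← b.sum_repr' u, ← b.sum_repr' v]
    simp only [map_sum, LinearMap.sum_apply, map_smul, LinearMap.smul_apply, smul_eq_mul]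
    refine Finset.sum_congr rfl fun i _ => ?_
    rw [Finset.sum_eq_single i]
    · ring
    · intro j _ hj
      rw [hoff _ _ hj]
      simp
    · simp
  rw [hexp, ← b.sum_inner_mul_inner u v, Finset.sum_mul, Finset.sum_mul]
  refine Finset.sum_congr rfl fun i _ => ?_
  rw [← hconst i, real_inner_comm u (b i)]
  ring

theorem integral_comp_of_measurePreserving {X Y : Type*} [MeasurableSpace X] [MeasurableSpace Y]
    {μ : Measure X} {ν : Measure Y} {g : X → Y} (hg : MeasurePreserving g μ ν) {f : Y → ℝ}
    (hf : AEStronglyMeasurable f ν) : ∫ x, f (g x) ∂μ = ∫ y, f y ∂ν := by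
  rw [← hg.map_eq] at hf ⊢
  exact (integral_map hg.measurable.aemeasurable hf).symm

theorem measurePreserving_pi_comp_equiv {ι X : Type*} [Fintype ι] [MeasurableSpace X]
    (γ : Measure X) [SigmaFinite γ] (e : ι ≃ ι) :
    MeasurePreserving (fun (x : ι → X) j => x (e j)) (Measure.pi fun _ : ι => γ)
      (Measure.pi fun _ : ι => γ) := by
  have hm : Measurable fun (x : ι → X) j => x (e j) := by fun_prop
  refine ⟨hm, (Measure.pi_eq fun A hA => ?_).symm⟩
  have hpre : (fun (x : ι → X) j => x (e j)) ⁻¹' (Set.univ.pi A)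
      = Set.univ.pi fun i => A (e.symm i) := by
    ext x
    simp only [Set.mem_preimage, Set.mem_pi, Set.mem_univ, true_imp_iff]
    exact ⟨fun h i => by simpa using h (e.symm i), fun h i => by simpa using h (e i)⟩
  rw [Measure.map_apply hm (MeasurableSet.univ_pi hA), hpre, Measure.pi_pi]
  exact e.symm.prod_comp fun i => γ (A i)

section GaussianMoments

variable {ι F : Type*} [Fintype ι] [DecidableEq ι] [NormedAddCommGroup F] [InnerProductSpace ℝ F]
  [FiniteDimensional ℝ F] [MeasurableSpace F] [BorelSpace F]

theorem integrable_invGram_mul_mul (h : Fintype.card ι + 1 < Module.finrank ℝ F) (s t : ι)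
    {a b : (ι → F) → ℝ} (ha : Measurable a) (hb : Measurable b)
    (hia : Integrable (fun x => invGram x s s * a x ^ 2) (Measure.pi fun _ : ι => stdGaussian F))
    (hib : Integrable (fun x => invGram x t t * b x ^ 2) (Measure.pi fun _ : ι => stdGaussian F)) :
    Integrable (fun x => invGram x s t * a x * b x) (Measure.pi fun _ : ι => stdGaussian F) := by
  refine (hia.add hib).mono' (((measurable_invGram s t).mul ha).mul hb).aestronglyMeasurable ?_
  filter_upwards [ae_linearIndependent_stdGaussian h] with x hx
  exact abs_invGram_mul_le hx s t _ _

theorem integrable_invGram_self_mul_inner_sq (h : Fintype.card ι + 1 < Module.finrank ℝ F) (s : ι)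
    (v : F) :
    Integrable (fun x => invGram x s s * inner ℝ (x s) v ^ 2)
      (Measure.pi fun _ : ι => stdGaussian F) := by
  refine ((integral_invGram_self_mul_normSq h s).1.mul_const (‖v‖ ^ 2)).mono'
    ((measurable_invGram s s).mul (by fun_prop)).aestronglyMeasurable (ae_of_all _ fun x => ?_)
  have h0 := invGram_self_nonneg x s
  rw [Real.norm_of_nonneg (by positivity), mul_assoc, ← mul_pow, ← sq_abs (inner ℝ (x s) v)]
  gcongr
  exact abs_real_inner_le_norm _ _

theorem integrable_invGram (h : Fintype.card ι + 1 < Module.finrank ℝ F) (s t : ι) :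
    Integrable (fun x => invGram x s t) (Measure.pi fun _ : ι => stdGaussian F) := by
  simpa using integrable_invGram_mul_mul h s t (a := fun _ => 1) (b := fun _ => 1)
    measurable_const measurable_const (by simpa using (integral_invGram_self h s).1)
    (by simpa using (integral_invGram_self h t).1)

theorem integrable_invGram_mul_inner (h : Fintype.card ι + 1 < Module.finrank ℝ F) (s t : ι)
    (v : F) :
    Integrable (fun x => invGram x s t * inner ℝ (x s) v)
      (Measure.pi fun _ : ι => stdGaussian F) := by
  simpa using integrable_invGram_mul_mul h s t (a := fun x => inner ℝ (x s) v) (b := fun _ => 1)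
    (by fun_prop) measurable_const (integrable_invGram_self_mul_inner_sq h s v)
    (by simpa using (integral_invGram_self h t).1)

theorem integrable_invGram_mul_inner_mul_inner (h : Fintype.card ι + 1 < Module.finrank ℝ F)
    (s t : ι) (u v : F) :
    Integrable (fun x => invGram x s t * inner ℝ (x s) u * inner ℝ (x t) v)
      (Measure.pi fun _ : ι => stdGaussian F) :=
  integrable_invGram_mul_mul h s t (by fun_prop) (by fun_prop)
    (integrable_invGram_self_mul_inner_sq h s u) (integrable_invGram_self_mul_inner_sq h t v)

/-- The second moments `E[(G⁻¹)ₛₜ ⟨xₛ, u⟩ ⟨xₜ, v⟩]`, as a bilinear form in `u` and `v`. -/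
noncomputable def invGramMoment (h : Fintype.card ι + 1 < Module.finrank ℝ F) (s t : ι) :
    F →ₗ[ℝ] F →ₗ[ℝ] ℝ :=
  LinearMap.mk₂ ℝ
    (fun u v => ∫ x, invGram x s t * inner ℝ (x s) u * inner ℝ (x t) v
      ∂(Measure.pi fun _ : ι => stdGaussian F))
    (fun u u' v => by
      rw [← integral_add (integrable_invGram_mul_inner_mul_inner h s t u v)
        (integrable_invGram_mul_inner_mul_inner h s t u' v)]
      refine integral_congr_ae (ae_of_all _ fun x => ?_)
      simp only [inner_add_right]
      ring)
    (fun c u v => by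
      rw [smul_eq_mul, ← integral_const_mul]
      refine integral_congr_ae (ae_of_all _ fun x => ?_)
      simp only [inner_smul_right]
      ring)
    (fun u v v' => by
      rw [← integral_add (integrable_invGram_mul_inner_mul_inner h s t u v)
        (integrable_invGram_mul_inner_mul_inner h s t u v')]
      refine integral_congr_ae (ae_of_all _ fun x => ?_)
      simp only [inner_add_right]
      ring)
    (fun c u v => by
      rw [smul_eq_mul, ← integral_const_mul]
      refine integral_congr_ae (ae_of_all _ fun x => ?_)
      simp only [inner_smul_right]
      ring)

theorem invGramMoment_apply (h : Fintype.card ι + 1 < Module.finrank ℝ F) (s t : ι) (u v : F) :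
    invGramMoment h s t u v = ∫ x, invGram x s t * inner ℝ (x s) u * inner ℝ (x t) v
      ∂(Measure.pi fun _ : ι => stdGaussian F) := rfl

/-- Applying O to every feature changes neither their joint law nor their Gram matrix, so O can be
moved from u, v onto the features and absorbed. -/
theorem invGramMoment_isometry (h : Fintype.card ι + 1 < Module.finrank ℝ F) (s t : ι)
    (O : F ≃ₗᵢ[ℝ] F) (u v : F) :
    invGramMoment h s t (O u) (O v) = invGramMoment h s t u v := by
  have hO : MeasurePreserving O (stdGaussian F) (stdGaussian F) :=
    ⟨O.continuous.measurable, stdGaussian_map O⟩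
  have hmp := measurePreserving_pi (fun _ : ι => stdGaussian F) (fun _ : ι => stdGaussian F)
    fun _ => hO
  have hm := ((measurable_invGram s t (F := F)).mul
    (by fun_prop : Measurable fun x : ι → F => inner ℝ (x s) (O u))).mul
    (by fun_prop : Measurable fun x : ι → F => inner ℝ (x t) (O v))
  rw [invGramMoment_apply, invGramMoment_apply]
  refine (integral_comp_of_measurePreserving hmp hm.aestronglyMeasurable).symm.trans ?_
  simp [invGram_comp_linearIsometryEquiv]

theorem integrable_invGram_mul_inner_pair (h : Fintype.card ι + 1 < Module.finrank ℝ F) (s t : ι) :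
    Integrable (fun x => invGram x s t * inner ℝ (x s) (x t))
      (Measure.pi fun _ : ι => stdGaussian F) := by
  have hi := integrable_finsetSum Finset.univ fun i _ =>
    integrable_invGram_mul_inner_mul_inner h s t (stdOrthonormalBasis ℝ F i)
      (stdOrthonormalBasis ℝ F i)
  refine hi.congr (ae_of_all _ fun x => ?_)
  simp only
  rw [← (stdOrthonormalBasis ℝ F).sum_inner_mul_inner (x s) (x t), Finset.mul_sum]
  refine Finset.sum_congr rfl fun i _ => ?_
  rw [real_inner_comm (x t)]
  ring

/-- The trace of the moment form over an orthonormal basis is E[g_st ⟨x_s, x_t⟩], so this scalar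
determines the whole form. -/
theorem invGramMoment_mul_finrank (h : Fintype.card ι + 1 < Module.finrank ℝ F) (s t : ι)
    (u v : F) :
    invGramMoment h s t u v * Module.finrank ℝ F = inner ℝ u v *
      ∫ x, invGram x s t * inner ℝ (x s) (x t) ∂(Measure.pi fun _ : ι => stdGaussian F) := by
  rw [apply_mul_finrank_eq_of_isometry_invariant (stdOrthonormalBasis ℝ F) _
    (invGramMoment_isometry h s t)]
  simp only [invGramMoment_apply]
  rw [← integral_finsetSum _ fun i _ => integrable_invGram_mul_inner_mul_inner h s t _ _]
  congr 2
  ext x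
  rw [← (stdOrthonormalBasis ℝ F).sum_inner_mul_inner (x s) (x t), Finset.mul_sum]
  refine Finset.sum_congr rfl fun i _ => ?_
  rw [real_inner_comm (x t)]
  ring

theorem integral_invGram_mul_inner_pair (h : Fintype.card ι + 1 < Module.finrank ℝ F) (s t : ι) :
    ∫ x, invGram x s t * inner ℝ (x s) (x t) ∂(Measure.pi fun _ : ι => stdGaussian F)
      = ((Module.finrank ℝ F - 1) * (if s = t then 1 else 0) - 1)
          / (Module.finrank ℝ F - Fintype.card ι - 1) := by
  have hd : ∫ x, invGram x s s * inner ℝ (x s) (x s) ∂(Measure.pi fun _ : ι => stdGaussian F)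
      = (Module.finrank ℝ F - 2) / (Module.finrank ℝ F - Fintype.card ι - 1) := by
    simpa only [real_inner_self_eq_norm_sq] using (integral_invGram_self_mul_normSq h s).2
  by_cases hst : s = t
  · subst hst
    rw [hd, if_pos rfl]
    ring_nf
  -- Transposing t and t' while fixing s preserves the joint law, so all off-diagonal entries of row
  -- s have equal mean.
  · have hex : ∀ t', t' ≠ s →
        ∫ x, invGram x s t' * inner ℝ (x s) (x t') ∂(Measure.pi fun _ : ι => stdGaussian F)
          = ∫ x, invGram x s t * inner ℝ (x s) (x t) ∂(Measure.pi fun _ : ι => stdGaussian F) := by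
      intro t' ht'
      have hmp := measurePreserving_pi_comp_equiv (stdGaussian F) (Equiv.swap t t')
      have hm := (measurable_invGram s t (F := F)).mul
        (by fun_prop : Measurable fun x : ι → F => inner ℝ (x s) (x t))
      refine Eq.trans ?_ (integral_comp_of_measurePreserving hmp hm.aestronglyMeasurable)
      simp only [invGram_comp_perm, Equiv.swap_apply_left,
        Equiv.swap_apply_of_ne_of_ne hst ht'.symm]
    -- The diagonal entry of G⁻¹G = 1, averaged: the known diagonal mean plus N - 1 equal
    -- off-diagonal means is 1, which is solved for the latter.
    have hsum : ∑ j, ∫ x, invGram x s j * inner ℝ (x s) (x j)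
        ∂(Measure.pi fun _ : ι => stdGaussian F) = 1 := by
      rw [← integral_finsetSum _ fun j _ => integrable_invGram_mul_inner_pair h s j]
      have hae : (fun x : ι → F => ∑ j, invGram x s j * inner ℝ (x s) (x j))
          =ᵐ[Measure.pi fun _ : ι => stdGaussian F] fun _ => (1 : ℝ) := by
        filter_upwards [ae_linearIndependent_stdGaussian h] with x hx
        have h1 := sum_invGram_mul_inner hx s s
        rw [if_pos rfl] at h1
        rw [← h1]
        exact Finset.sum_congr rfl fun j _ => by rw [real_inner_comm]
      rw [integral_congr_ae hae]
      simp
    rw [← Finset.add_sum_erase _ _ (Finset.mem_univ s), hd,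
      Finset.sum_congr rfl fun j hj => hex j (Finset.ne_of_mem_erase hj), Finset.sum_const,
      Finset.card_erase_of_mem (Finset.mem_univ s), Finset.card_univ, nsmul_eq_mul] at hsum
    have hcard : 1 < Fintype.card ι := Fintype.one_lt_card_iff.2 ⟨s, t, hst⟩
    rw [Nat.cast_sub hcard.le] at hsum
    have hc1 : (1 : ℝ) < Fintype.card ι := by exact_mod_cast hcard
    have hp : (Fintype.card ι : ℝ) + 1 < Module.finrank ℝ F := by exact_mod_cast h
    have hne : (Module.finrank ℝ F : ℝ) - Fintype.card ι - 1 ≠ 0 := by linarith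
    have hne2 : (Fintype.card ι : ℝ) - 1 ≠ 0 := by linarith
    rw [if_neg hst]
    refine mul_left_cancel₀ hne2 ?_
    rw [Nat.cast_one] at hsum
    rw [eq_sub_of_add_eq' hsum]
    field_simp
    ring

theorem integral_invGram_mul_inner_mul_inner (h : Fintype.card ι + 1 < Module.finrank ℝ F)
    (s t : ι) (u v : F) :
    ∫ x, invGram x s t * inner ℝ (x s) u * inner ℝ (x t) v
        ∂(Measure.pi fun _ : ι => stdGaussian F)
      = ((Module.finrank ℝ F - 1) * (if s = t then 1 else 0) - 1)
          / (Module.finrank ℝ F * (Module.finrank ℝ F - Fintype.card ι - 1)) * inner ℝ u v := by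
  have h1 := invGramMoment_mul_finrank h s t u v
  rw [integral_invGram_mul_inner_pair h, invGramMoment_apply] at h1
  have hp : (0 : ℝ) < Module.finrank ℝ F := by
    exact_mod_cast (by omega : 0 < Module.finrank ℝ F)
  rw [← div_div, eq_div_of_mul_eq hp.ne' h1]
  ring

end GaussianMoments

/-! ### The minimum-norm interpolator and its error for fixed data. -/

section Interpolation

variable {p : ℕ} {ι : Type*} [Fintype ι] [DecidableEq ι]

theorem isMinNormInterpolator_iff {x : ι → Param p} (hx : LinearIndependent ℝ x) (y : ι → ℝ)
    (w : Param p) : IsMinNormInterpolator x y w ↔ w = ∑ s, y s • dualFamily x s := by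
  set u := ∑ s, y s • dualFamily x s with hu
  have hmem : u ∈ interpolators x y := fun i => by
    rw [hu, inner_sum]
    simp only [real_inner_smul_right, real_inner_comm (dualFamily x _), inner_dualFamily hx]
    simp
  -- The candidate u lies in the span of the features, whereas the difference of two interpolators
  -- is orthogonal to that span; Pythagoras gives minimality and uniqueness together.
  have hpyth : ∀ v ∈ interpolators x y, ‖v‖ ^ 2 = ‖u‖ ^ 2 + ‖v - u‖ ^ 2 := fun v hv => by
    have hD : ∀ s, inner ℝ (dualFamily x s) (v - u) = 0 := fun s => by
      rw [inner_dualFamily_eq_sum]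
      refine Finset.sum_eq_zero fun j _ => ?_
      rw [inner_sub_right, hv j, hmem j, sub_self, mul_zero]
    have h0 : inner ℝ u (v - u) = 0 := by
      conv_lhs => rw [hu, sum_inner]
      refine Finset.sum_eq_zero fun s _ => ?_
      rw [real_inner_smul_left, hD, mul_zero]
    have h1 := norm_add_sq_real u (v - u)
    rw [h0, add_sub_cancel] at h1
    linarith
  constructor
  · rintro ⟨hw, hmin⟩
    have h1 := hmin hmem
    have h2 := hpyth w hw
    simp only [Set.mem_ofPred_eq] at h1
    have h3 : ‖w - u‖ ^ 2 = 0 := le_antisymm (by linarith) (sq_nonneg _)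
    exact sub_eq_zero.1 (norm_eq_zero.1 (pow_eq_zero_iff two_ne_zero |>.1 h3))
  · rintro rfl
    refine ⟨hmem, fun v hv => ?_⟩
    have h2 := hpyth v hv
    simp only [Set.mem_ofPred_eq]
    nlinarith [sq_nonneg ‖v - u‖]

theorem existsUnique_isMinNormInterpolator {x : ι → Param p} (hx : LinearIndependent ℝ x)
    (y : ι → ℝ) : ∃! w, IsMinNormInterpolator x y w :=
  ⟨_, (isMinNormInterpolator_iff hx y _).2 rfl, fun w hw => (isMinNormInterpolator_iff hx y w).1 hw⟩

theorem minNormInterpolator_eq_sum {x : ι → Param p} (hx : LinearIndependent ℝ x) (y : ι → ℝ) :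
    minNormInterpolator x y = ∑ s, y s • dualFamily x s := by
  have h := (existsUnique_isMinNormInterpolator hx y).exists
  rw [minNormInterpolator, dif_pos h]
  exact (isMinNormInterpolator_iff hx y _).1 h.choose_spec

/-- The interpolator is Pw + Σ a_s d_s, so the error is a vector Σ a_s d_s in the span minus the
part w - Pw orthogonal to it, and no cross term survives. -/
theorem normSq_minNormInterpolator_sub {x : ι → Param p} (hx : LinearIndependent ℝ x)
    (a : ι → ℝ) (w : Param p) :
    ‖minNormInterpolator x (fun s => inner ℝ (x s) w + a s) - w‖ ^ 2
      = ∑ s, ∑ t, invGram x s t * a s * a t + ‖w‖ ^ 2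
        - ∑ s, ∑ t, invGram x s t * inner ℝ (x s) w * inner ℝ (x t) w := by
  rw [minNormInterpolator_eq_sum hx]
  set y : ι → ℝ := fun s => inner ℝ (x s) w + a s with hy
  have h1 : ‖∑ s, y s • dualFamily x s‖ ^ 2 = ∑ s, ∑ t, invGram x s t * y s * y t := by
    rw [← real_inner_self_eq_norm_sq, sum_inner]
    refine Finset.sum_congr rfl fun s _ => ?_
    rw [inner_sum]
    refine Finset.sum_congr rfl fun t _ => ?_
    rw [real_inner_smul_left, real_inner_smul_right, inner_dualFamily_dualFamily hx]
    ring
  have h2 : inner ℝ (∑ s, y s • dualFamily x s) w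
      = ∑ s, ∑ t, invGram x s t * y s * inner ℝ (x t) w := by
    rw [sum_inner]
    refine Finset.sum_congr rfl fun s _ => ?_
    rw [real_inner_smul_left, inner_dualFamily_eq_sum, Finset.mul_sum]
    exact Finset.sum_congr rfl fun t _ => by ring
  -- By symmetry of G⁻¹ the cross term is written a second way; subtracting one copy of each form
  -- completes the square in a = y - ⟨x, w⟩.
  have h3 : inner ℝ (∑ s, y s • dualFamily x s) w
      = ∑ s, ∑ t, invGram x s t * inner ℝ (x s) w * y t := by
    rw [h2, Finset.sum_comm]
    exact Finset.sum_congr rfl fun s _ => Finset.sum_congr rfl fun t _ => by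
      rw [invGram_symm x t s]; ring
  have h4 : ∑ s, ∑ t, invGram x s t * y s * y t - ∑ s, ∑ t, invGram x s t * y s * inner ℝ (x t) w
      - ∑ s, ∑ t, invGram x s t * inner ℝ (x s) w * y t
      = ∑ s, ∑ t, invGram x s t * a s * a t
        - ∑ s, ∑ t, invGram x s t * inner ℝ (x s) w * inner ℝ (x t) w := by
    simp only [← Finset.sum_sub_distrib]
    refine Finset.sum_congr rfl fun s _ => Finset.sum_congr rfl fun t _ => ?_
    simp only [hy]
    ring
  rw [norm_sub_sq_real, h1]
  linarith

end Interpolation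

/-! ### Expectations under the data model, and the expected loss for one target. -/

namespace IsGaussianData

variable {Ω ι : Type*} [MeasurableSpace Ω] {μ : Measure Ω} {p : ℕ} {σ : ℝ}
  {x : ι → Ω → Param p} {z : ι → Ω → ℝ}

theorem comp_injective (h : IsGaussianData μ σ x z) {κ : Type*} {f : κ → ι}
    (hf : Function.Injective f) : IsGaussianData μ σ (fun i => x (f i)) (fun i => z (f i)) where
  feature_law i := h.feature_law (f i)
  noise_law i := h.noise_law (f i)
  feature_indep := h.feature_indep.precomp hf
  noise_indep := h.noise_indep.precomp hf
  feature_noise_indep := h.feature_noise_indep.comp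
    (φ := fun (v : ι → Param p) i => v (f i)) (ψ := fun (v : ι → ℝ) i => v (f i))
    (by fun_prop) (by fun_prop)

theorem hasLaw_features [Fintype ι] (h : IsGaussianData μ σ x z) :
    HasLaw (fun ω i => x i ω) (Measure.pi fun _ : ι => stdGaussian (Param p)) μ where
  aemeasurable := aemeasurable_pi_lambda _ fun i => (h.feature_law i).aemeasurable
  map_eq := by
    rw [h.feature_indep.map_fun_eq_pi_map fun i => (h.feature_law i).aemeasurable]
    congr 1
    ext1 i
    exact (h.feature_law i).map_eq

theorem exists_hasLaw_noise (h : IsGaussianData μ σ x z) :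
    ∃ v : NNReal, (v : ℝ) = σ ^ 2 ∧ ∀ i, HasLaw (z i) (gaussianReal 0 v) μ :=
  ⟨NNReal.mk (σ ^ 2) (sq_nonneg σ), rfl, h.noise_law⟩

theorem memLp_noise (h : IsGaussianData μ σ x z) (s : ι) : MemLp (z s) 2 μ := by
  obtain ⟨v, -, hlaw⟩ := h.exists_hasLaw_noise
  have hm := IsGaussian.memLp_two_id (μ := gaussianReal 0 v)
  rw [← (hlaw s).map_eq] at hm
  exact (memLp_map_measure_iff (by fun_prop) (hlaw s).aemeasurable).1 hm

theorem integral_noise (h : IsGaussianData μ σ x z) (s : ι) : ∫ ω, z s ω ∂μ = 0 := by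
  obtain ⟨v, -, hlaw⟩ := h.exists_hasLaw_noise
  rw [(hlaw s).integral_eq]
  exact integral_id_gaussianReal

theorem integrable_noise_mul (h : IsGaussianData μ σ x z) (s t : ι) :
    Integrable (fun ω => z s ω * z t ω) μ :=
  (h.memLp_noise s).integrable_mul (h.memLp_noise t)

theorem integral_noise_mul [DecidableEq ι] [IsProbabilityMeasure μ] (h : IsGaussianData μ σ x z)
    (s t : ι) : ∫ ω, z s ω * z t ω ∂μ = if s = t then σ ^ 2 else 0 := by
  split_ifs with hst
  · subst hst
    obtain ⟨v, hvσ, hlaw⟩ := h.exists_hasLaw_noise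
    have hv := (hlaw s).variance_eq
    rw [variance_of_integral_eq_zero (hlaw s).aemeasurable (h.integral_noise s),
      variance_id_gaussianReal, hvσ] at hv
    simp only [← pow_two]
    exact hv
  · rw [(h.noise_indep.indepFun hst).integral_fun_mul_eq_mul_integral
      (h.memLp_noise s).aestronglyMeasurable (h.memLp_noise t).aestronglyMeasurable,
      h.integral_noise, zero_mul]

variable [Fintype ι]

theorem ae_linearIndependent (h : IsGaussianData μ σ x z) (hp : Fintype.card ι + 2 ≤ p) :
    ∀ᵐ ω ∂μ, LinearIndependent ℝ fun i => x i ω := by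
  classical
  have hdim : Fintype.card ι + 1 < Module.finrank ℝ (Param p) := by
    rw [finrank_euclideanSpace_fin]; omega
  have hae := ae_linearIndependent_stdGaussian (ι := ι) hdim
  rw [← h.hasLaw_features.map_eq] at hae
  exact ae_of_ae_map h.hasLaw_features.aemeasurable hae

theorem integral_features (h : IsGaussianData μ σ x z) {f : (ι → Param p) → ℝ}
    (hf : Integrable f (Measure.pi fun _ : ι => stdGaussian (Param p))) :
    Integrable (fun ω => f fun i => x i ω) μ ∧ ∫ ω, f (fun i => x i ω) ∂μ
      = ∫ v, f v ∂(Measure.pi fun _ : ι => stdGaussian (Param p)) := by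
  have hlaw := h.hasLaw_features
  rw [← hlaw.map_eq] at hf ⊢
  exact ⟨(integrable_map_measure hf.aestronglyMeasurable hlaw.aemeasurable).1 hf,
    (integral_map hlaw.aemeasurable hf.aestronglyMeasurable).symm⟩

theorem integral_features_mul_noise (h : IsGaussianData μ σ x z) {f : (ι → Param p) → ℝ}
    {g : (ι → ℝ) → ℝ} (hfm : Measurable f) (hg : Measurable g)
    (hf : Integrable f (Measure.pi fun _ : ι => stdGaussian (Param p)))
    (hgi : Integrable (fun ω => g fun i => z i ω) μ) :
    Integrable (fun ω => f (fun i => x i ω) * g fun i => z i ω) μ ∧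
      ∫ ω, f (fun i => x i ω) * g (fun i => z i ω) ∂μ
        = (∫ v, f v ∂(Measure.pi fun _ : ι => stdGaussian (Param p)))
          * ∫ ω, g (fun i => z i ω) ∂μ := by
  have hind : IndepFun (fun ω => f fun i => x i ω) (fun ω => g fun i => z i ω) μ :=
    h.feature_noise_indep.comp hfm hg
  obtain ⟨hi, hv⟩ := h.integral_features hf
  refine ⟨hind.integrable_mul hi hgi, ?_⟩
  rw [← hv]
  exact hind.integral_fun_mul_eq_mul_integral hi.aestronglyMeasurable hgi.aestronglyMeasurable

variable [DecidableEq ι]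

theorem integral_invGram_mul_residuals [IsProbabilityMeasure μ] (h : IsGaussianData μ σ x z)
    (hp : Fintype.card ι + 2 ≤ p) (v : ι → Param p) (s t : ι) :
    Integrable (fun ω => invGram (fun i => x i ω) s t * (inner ℝ (x s ω) (v s) + z s ω)
      * (inner ℝ (x t ω) (v t) + z t ω)) μ ∧
    ∫ ω, invGram (fun i => x i ω) s t * (inner ℝ (x s ω) (v s) + z s ω)
      * (inner ℝ (x t ω) (v t) + z t ω) ∂μ
      = ((p - 1) * (if s = t then 1 else 0) - 1) / (p * (p - Fintype.card ι - 1))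
          * inner ℝ (v s) (v t)
        + (if s = t then σ ^ 2 / (p - Fintype.card ι - 1) else 0) := by
  have hdim : Fintype.card ι + 1 < Module.finrank ℝ (Param p) := by
    rw [finrank_euclideanSpace_fin]; omega
  have hm := measurable_invGram (ι := ι) (F := Param p)
  obtain ⟨i1, e1⟩ := h.integral_features
    (integrable_invGram_mul_inner_mul_inner hdim s t (v s) (v t))
  obtain ⟨i2, e2⟩ := h.integral_features_mul_noise (f := fun x => invGram x s t * inner ℝ (x s) (v s))
    ((hm s t).mul (by fun_prop))
    (measurable_pi_apply t) (integrable_invGram_mul_inner hdim s t (v s))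
    ((h.memLp_noise t).integrable one_le_two)
  obtain ⟨i3, e3⟩ := h.integral_features_mul_noise (f := fun x => invGram x t s * inner ℝ (x t) (v t))
    ((hm t s).mul (by fun_prop))
    (measurable_pi_apply s) (integrable_invGram_mul_inner hdim t s (v t))
    ((h.memLp_noise s).integrable one_le_two)
  obtain ⟨i4, e4⟩ := h.integral_features_mul_noise (hm s t)
    (g := fun u => u s * u t) (by fun_prop) (integrable_invGram hdim s t)
    (h.integrable_noise_mul s t)
  beta_reduce at i1 e1 i2 e2 i3 e3 i4 e4
  -- The two terms linear in the noise average to zero, the noise being centred and independent of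
  -- the features. In the third term the entry is transposed so that its feature factor has the same
  -- shape as in the second.
  have heq : (fun ω => invGram (fun i => x i ω) s t * (inner ℝ (x s ω) (v s) + z s ω)
      * (inner ℝ (x t ω) (v t) + z t ω)) = fun ω =>
      invGram (fun i => x i ω) s t * inner ℝ (x s ω) (v s) * inner ℝ (x t ω) (v t)
      + invGram (fun i => x i ω) s t * inner ℝ (x s ω) (v s) * z t ω
      + invGram (fun i => x i ω) t s * inner ℝ (x t ω) (v t) * z s ω
      + invGram (fun i => x i ω) s t * (z s ω * z t ω) := by
    ext ω
    rw [invGram_symm _ t s]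
    ring
  rw [heq]
  have i12 := i1.fun_add i2
  have i123 := i12.fun_add i3
  refine ⟨i123.fun_add i4, ?_⟩
  rw [integral_add i123 i4, integral_add i12 i3, integral_add i1 i2,
    e1, e2, e3, e4, h.integral_noise, h.integral_noise, h.integral_noise_mul,
    integral_invGram_mul_inner_mul_inner hdim, finrank_euclideanSpace_fin, mul_zero, mul_zero,
    add_zero, add_zero]
  congr 1
  split_ifs with hst
  · subst hst
    rw [(integral_invGram_self hdim s).2, finrank_euclideanSpace_fin]
    ring
  · rw [mul_zero]

theorem integral_loss [IsProbabilityMeasure μ] (h : IsGaussianData μ σ x z)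
    (hp : Fintype.card ι + 2 ≤ p) (ws : ι → Param p) (w : Param p) :
    Integrable (fun ω => ‖minNormInterpolator (fun s => x s ω)
      (fun s => inner ℝ (x s ω) (ws s) + z s ω) - w‖ ^ 2) μ ∧
    ∫ ω, ‖minNormInterpolator (fun s => x s ω)
      (fun s => inner ℝ (x s ω) (ws s) + z s ω) - w‖ ^ 2 ∂μ
      = ((p - 1) * ∑ s, ‖ws s - w‖ ^ 2 - ‖∑ s, (ws s - w)‖ ^ 2) / (p * (p - Fintype.card ι - 1))
        + (1 - (Fintype.card ι : ℝ) / p) * ‖w‖ ^ 2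
        + Fintype.card ι * σ ^ 2 / (p - Fintype.card ι - 1) := by
  have hdim : Fintype.card ι + 1 < Module.finrank ℝ (Param p) := by
    rw [finrank_euclideanSpace_fin]; omega
  have hpr : (Fintype.card ι : ℝ) + 2 ≤ p := by exact_mod_cast hp
  have hres := h.integral_invGram_mul_residuals hp fun s => ws s - w
  have hproj := fun s t => h.integral_features (integrable_invGram_mul_inner_mul_inner hdim s t w w)
  have hae : (fun ω => ‖minNormInterpolator (fun s => x s ω)
      (fun s => inner ℝ (x s ω) (ws s) + z s ω) - w‖ ^ 2) =ᵐ[μ] fun ω =>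
      ∑ s, ∑ t, invGram (fun i => x i ω) s t * (inner ℝ (x s ω) (ws s - w) + z s ω)
        * (inner ℝ (x t ω) (ws t - w) + z t ω) + ‖w‖ ^ 2
      - ∑ s, ∑ t, invGram (fun i => x i ω) s t * inner ℝ (x s ω) w * inner ℝ (x t ω) w := by
    filter_upwards [h.ae_linearIndependent hp] with ω hω
    rw [← normSq_minNormInterpolator_sub hω (fun s => inner ℝ (x s ω) (ws s - w) + z s ω) w]
    congr 4
    ext s
    rw [inner_sub_right]
    ring
  have i1 : Integrable (fun ω => ∑ s, ∑ t, invGram (fun i => x i ω) s t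
      * (inner ℝ (x s ω) (ws s - w) + z s ω) * (inner ℝ (x t ω) (ws t - w) + z t ω)) μ :=
    integrable_finsetSum _ fun s _ => integrable_finsetSum _ fun t _ => (hres s t).1
  have i2 : Integrable (fun ω => ∑ s, ∑ t, invGram (fun i => x i ω) s t
      * inner ℝ (x s ω) w * inner ℝ (x t ω) w) μ :=
    integrable_finsetSum _ fun s _ => integrable_finsetSum _ fun t _ => (hproj s t).1
  have i3 := i1.fun_add (integrable_const (μ := μ) (‖w‖ ^ 2))
  refine ⟨(i3.sub i2).congr hae.symm, ?_⟩
  rw [integral_congr_ae hae, integral_sub i3 i2,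
    integral_add i1 (integrable_const _),
    integral_finsetSum _ fun s _ => integrable_finsetSum _ fun t _ => (hres s t).1,
    integral_finsetSum _ fun s _ => integrable_finsetSum _ fun t _ => (hproj s t).1]
  have e1 : ∀ v : ι → Param p, ∑ s, ∑ t, ((p - 1 : ℝ) * (if s = t then 1 else 0) - 1)
      / (p * (p - Fintype.card ι - 1)) * inner ℝ (v s) (v t)
      = ((p - 1) * ∑ s, ‖v s‖ ^ 2 - ‖∑ s, v s‖ ^ 2) / (p * (p - Fintype.card ι - 1)) := fun v => by
    rw [← real_inner_self_eq_norm_sq (∑ s, v s), sum_inner, Finset.mul_sum,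
      ← Finset.sum_sub_distrib, Finset.sum_div]
    refine Finset.sum_congr rfl fun s _ => ?_
    have hs : ∑ t, (if s = t then (1 : ℝ) else 0) * inner ℝ (v s) (v t) = ‖v s‖ ^ 2 := by
      simp only [ite_mul, one_mul, zero_mul, Finset.sum_ite_eq, Finset.mem_univ, if_true,
        real_inner_self_eq_norm_sq]
    rw [inner_sum, ← hs, Finset.mul_sum, ← Finset.sum_sub_distrib, Finset.sum_div]
    exact Finset.sum_congr rfl fun t _ => by ring
  have e2 : ∀ s, ∫ ω, ∑ t, invGram (fun i => x i ω) s t * (inner ℝ (x s ω) (ws s - w) + z s ω)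
      * (inner ℝ (x t ω) (ws t - w) + z t ω) ∂μ
      = ∑ t, (((p - 1) * (if s = t then 1 else 0) - 1) / (p * (p - Fintype.card ι - 1))
          * inner ℝ (ws s - w) (ws t - w)
        + (if s = t then σ ^ 2 / (p - Fintype.card ι - 1) else 0)) := fun s => by
    rw [integral_finsetSum _ fun t _ => (hres s t).1]
    exact Finset.sum_congr rfl fun t _ => (hres s t).2
  have e3 : ∀ s, ∫ ω, ∑ t, invGram (fun i => x i ω) s t * inner ℝ (x s ω) w
      * inner ℝ (x t ω) w ∂μ
      = ∑ t, ((p - 1) * (if s = t then 1 else 0) - 1) / (p * (p - Fintype.card ι - 1))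
          * inner ℝ w w := fun s => by
    rw [integral_finsetSum _ fun t _ => (hproj s t).1]
    refine Finset.sum_congr rfl fun t _ => ?_
    rw [(hproj s t).2, integral_invGram_mul_inner_mul_inner hdim, finrank_euclideanSpace_fin]
  simp only [e2, e3, Finset.sum_add_distrib]
  -- The same moment formula serves twice. For the constant family w it gives N(p - 1 - N)‖w‖²/(p(p
  -- - N - 1)) = (N/p)‖w‖², the expected squared length of Pw.
  rw [e1 fun s => ws s - w, e1 fun _ => w]
  simp only [integral_const, probReal_univ, Finset.sum_ite_eq, Finset.mem_univ, if_true,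
    Finset.sum_const, Finset.card_univ, ← Nat.cast_smul_eq_nsmul ℝ, norm_smul,
    Real.norm_natCast, smul_eq_mul]
  have hne : (p : ℝ) - Fintype.card ι - 1 ≠ 0 := by linarith
  have hne2 : (p : ℝ) ≠ 0 := by
    have : (0 : ℝ) ≤ Fintype.card ι := Nat.cast_nonneg _
    linarith
  field_simp
  ring

end IsGaussianData

/-! ### Losses of the two learners and averages over tasks. -/

section Tasks

variable {Ω : Type*} [MeasurableSpace Ω] {μ : Measure Ω} [IsProbabilityMeasure μ] {T p : ℕ}
  {n : Fin T → ℕ} {σ : ℝ} {x : SampleIdx n → Ω → Param p} {z : SampleIdx n → Ω → ℝ}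

theorem card_sampleIdx (n : Fin T → ℕ) : Fintype.card (SampleIdx n) = ∑ t, n t := by
  simp [SampleIdx]

theorem IsGaussianData.integral_taskLoss_multiTaskLearner (h : IsGaussianData μ σ x z)
    (hp : ∑ t, n t + 2 ≤ p) (wstar : Fin T → Param p) (t : Fin T) :
    Integrable (fun ω => taskLoss wstar t
      (multiTaskLearner wstar (fun s => x s ω) fun s => z s ω)) μ ∧
    ∫ ω, taskLoss wstar t (multiTaskLearner wstar (fun s => x s ω) fun s => z s ω) ∂μ
      = ((p - 1) * ∑ i, (n i : ℝ) * ‖wstar i - wstar t‖ ^ 2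
            - ‖∑ i, (n i : ℝ) • (wstar i - wstar t)‖ ^ 2) / (p * (p - (∑ i, n i : ℕ) - 1))
        + (1 - ((∑ i, n i : ℕ) : ℝ) / p) * ‖wstar t‖ ^ 2
        + (∑ i, n i : ℕ) * σ ^ 2 / (p - (∑ i, n i : ℕ) - 1) := by
  have hl := h.integral_loss (by rwa [card_sampleIdx]) (fun s => wstar s.1) (wstar t)
  rw [card_sampleIdx, Fintype.sum_sigma, Fintype.sum_sigma] at hl
  simp only [Finset.sum_const, Finset.card_univ, Fintype.card_fin,
    ← Nat.cast_smul_eq_nsmul ℝ, smul_eq_mul] at hl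
  exact hl

theorem IsGaussianData.integral_taskLoss_singleTaskLearner (h : IsGaussianData μ σ x z)
    (wstar : Fin T → Param p) (t : Fin T) (hp : n t + 2 ≤ p) :
    Integrable (fun ω => taskLoss wstar t
      (singleTaskLearner wstar (fun s => x s ω) (fun s => z s ω) t)) μ ∧
    ∫ ω, taskLoss wstar t (singleTaskLearner wstar (fun s => x s ω) (fun s => z s ω) t) ∂μ
      = (1 - (n t : ℝ) / p) * ‖wstar t‖ ^ 2 + n t * σ ^ 2 / (p - n t - 1) := by
  have h' := h.comp_injective (f := fun i : Fin (n t) => (⟨t, i⟩ : SampleIdx n))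
    (sigma_mk_injective (β := fun t => Fin (n t)))
  have hl := h'.integral_loss (by rwa [Fintype.card_fin]) (fun _ => wstar t) (wstar t)
  simp only [Fintype.card_fin, sub_self, norm_zero, Finset.sum_const_zero, mul_zero, zero_div,
    zero_add, ne_eq, OfNat.ofNat_ne_zero, not_false_eq_true, zero_pow] at hl
  exact hl

/-- A weighted parallel-axis identity. It trades the norm of the summed deviations from w for
pairwise distances independent of w. -/
theorem normSq_sum_smul_sub {F κ : Type*} [NormedAddCommGroup F] [InnerProductSpace ℝ F]
    [Fintype κ] (a : κ → ℝ) (v : κ → F) (w : F) :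
    ‖∑ i, a i • (v i - w)‖ ^ 2 = (∑ i, a i) * ∑ i, a i * ‖v i - w‖ ^ 2
      - 1 / 2 * ∑ i, ∑ j, a i * a j * ‖v i - v j‖ ^ 2 := by
  have h1 : ∀ i j, a i * a j * ‖v i - v j‖ ^ 2 = a i * ‖v i - w‖ ^ 2 * a j
      + a i * (a j * ‖v j - w‖ ^ 2) - 2 * (a i * a j * inner ℝ (v i - w) (v j - w)) := fun i j => by
    rw [← sub_sub_sub_cancel_right (v i) (v j) w, norm_sub_sq_real (v i - w)]
    ring
  have h2 : ‖∑ i, a i • (v i - w)‖ ^ 2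
      = ∑ i, ∑ j, a i * a j * inner ℝ (v i - w) (v j - w) := by
    rw [← real_inner_self_eq_norm_sq, sum_inner]
    refine Finset.sum_congr rfl fun i _ => ?_
    rw [inner_sum]
    refine Finset.sum_congr rfl fun j _ => ?_
    rw [real_inner_smul_left, real_inner_smul_right, mul_assoc]
  simp only [h1, Finset.sum_sub_distrib, Finset.sum_add_distrib, ← Finset.mul_sum, ← Finset.sum_mul]
  rw [h2]
  ring

theorem IsGaussianData.integral_taskLoss_multiTaskLearner_pairwise (h : IsGaussianData μ σ x z)
    (hp : ∑ t, n t + 2 ≤ p) (wstar : Fin T → Param p) (t : Fin T) :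
    ∫ ω, taskLoss wstar t (multiTaskLearner wstar (fun s => x s ω) fun s => z s ω) ∂μ
      = (∑ i, (n i : ℝ) * ‖wstar t - wstar i‖ ^ 2) / p
        + (∑ i, ∑ j, (n i : ℝ) * n j * ‖wstar i - wstar j‖ ^ 2)
          / (2 * p * (p - (∑ i, n i : ℕ) - 1))
        + (1 - ((∑ i, n i : ℕ) : ℝ) / p) * ‖wstar t‖ ^ 2
        + (∑ i, n i : ℕ) * σ ^ 2 / (p - (∑ i, n i : ℕ) - 1) := by
  have hpr : ((∑ i, n i : ℕ) : ℝ) + 2 ≤ p := by exact_mod_cast hp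
  have hne : (p : ℝ) - (∑ i, n i : ℕ) - 1 ≠ 0 := by linarith
  have hne2 : (p : ℝ) ≠ 0 := by
    have : (0 : ℝ) ≤ (∑ i, n i : ℕ) := Nat.cast_nonneg _
    linarith
  -- With S = Σ n_i ‖w*_i - w*_t‖² and D the pairwise double sum, (p - 1)S - (NS - D/2) = (p - N -
  -- 1)S + D/2, so the denominator cancels in front of S.
  rw [(h.integral_taskLoss_multiTaskLearner hp wstar t).2, normSq_sum_smul_sub, ← Nat.cast_sum]
  simp only [norm_sub_rev (wstar t)]
  congr 2
  field_simp
  ring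

theorem IsGaussianData.integral_avgGenError (h : IsGaussianData μ σ x z) (hT : 0 < T)
    (hp : ∑ t, n t + 2 ≤ p) (wstar : Fin T → Param p) :
    Integrable (fun ω => avgGenError wstar (fun s => x s ω) fun s => z s ω) μ ∧
    ∫ ω, avgGenError wstar (fun s => x s ω) (fun s => z s ω) ∂μ
      = (∑ t, ∑ t', (n t' : ℝ) / (T * p) * (1 + T * n t / (2 * (p - (∑ i, n i : ℕ) - 1)))
          * ‖wstar t - wstar t'‖ ^ 2)
        + 1 / (T : ℝ) * (1 - ((∑ i, n i : ℕ) : ℝ) / p) * ∑ t, ‖wstar t‖ ^ 2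
        + (∑ i, n i : ℕ) * σ ^ 2 / ((p : ℝ) - (∑ i, n i : ℕ) - 1) := by
  have hl := h.integral_taskLoss_multiTaskLearner hp wstar
  refine ⟨(integrable_finsetSum _ fun t _ => (hl t).1).const_mul _, ?_⟩
  simp only [avgGenError]
  rw [integral_const_mul, integral_finsetSum _ fun t _ => (hl t).1]
  simp only [h.integral_taskLoss_multiTaskLearner_pairwise hp wstar, Finset.sum_add_distrib,
    Finset.sum_const, Finset.card_univ, Fintype.card_fin, nsmul_eq_mul]
  have hT' : (T : ℝ) ≠ 0 := by exact_mod_cast hT.ne'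
  have hpr : ((∑ i, n i : ℕ) : ℝ) + 2 ≤ p := by exact_mod_cast hp
  have hne : (p : ℝ) - (∑ i, n i : ℕ) - 1 ≠ 0 := by linarith
  have hne2 : (p : ℝ) ≠ 0 := by
    have : (0 : ℝ) ≤ (∑ i, n i : ℕ) := Nat.cast_nonneg _
    linarith
  -- The second sum comes from the pairwise term, which is the same for every task; averaging leaves
  -- it unchanged, hence the factor T beside n_t.
  have hsum : ∑ t, ∑ t', (n t' : ℝ) / (T * p) * (1 + T * n t / (2 * (p - (∑ i, n i : ℕ) - 1)))
      * ‖wstar t - wstar t'‖ ^ 2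
      = 1 / (T * p) * ∑ t, ∑ t', (n t' : ℝ) * ‖wstar t - wstar t'‖ ^ 2
        + 1 / (2 * p * (p - (∑ i, n i : ℕ) - 1))
          * ∑ t, ∑ t', (n t : ℝ) * n t' * ‖wstar t - wstar t'‖ ^ 2 := by
    simp only [Finset.mul_sum, ← Finset.sum_add_distrib]
    refine Finset.sum_congr rfl fun t _ => Finset.sum_congr rfl fun t' _ => ?_
    field_simp
  rw [hsum, ← Finset.sum_div, ← Finset.mul_sum]
  field_simp

/-- The noise-free part of the transfer, by expanding ‖w*_t - w*_t'‖². The N/p contributions to Σ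
‖w*_t‖² cancel; the weights 1/T, 1 and N/(p - N - 1) come respectively from the single-task loss,
from the sum over t of n_t' ‖w*_t'‖², and from the two symmetric pairwise terms. -/
theorem transfer_identity (wstar : Fin T → Param p) (n : Fin T → ℕ) (hT : 0 < T)
    (hp : ∑ t, n t + 2 ≤ p) :
    1 / (T : ℝ) * ∑ t, (1 - (n t : ℝ) / p) * ‖wstar t‖ ^ 2
      - ((∑ t, ∑ t', (n t' : ℝ) / (T * p) * (1 + T * n t / (2 * (p - (∑ i, n i : ℕ) - 1)))
          * ‖wstar t - wstar t'‖ ^ 2)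
        + 1 / (T : ℝ) * (1 - ((∑ i, n i : ℕ) : ℝ) / p) * ∑ t, ‖wstar t‖ ^ 2)
      = 2 * (∑ t, ∑ t', (n t' : ℝ) / (T * p) * (1 + T * n t / (2 * (p - (∑ i, n i : ℕ) - 1)))
          * inner ℝ (wstar t) (wstar t'))
        - (1 + 1 / (T : ℝ) + (∑ i, n i : ℕ) / ((p : ℝ) - (∑ i, n i : ℕ) - 1))
          * (∑ t, (n t : ℝ) / p * ‖wstar t‖ ^ 2) := by
  have hT' : (T : ℝ) ≠ 0 := by exact_mod_cast hT.ne'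
  have hpr : ((∑ i, n i : ℕ) : ℝ) + 2 ≤ p := by exact_mod_cast hp
  have hN : ((∑ i, n i : ℕ) : ℝ) = ∑ i, (n i : ℝ) := Nat.cast_sum _ _
  generalize ((∑ i, n i : ℕ) : ℝ) = N at *
  have hne : (p : ℝ) - N - 1 ≠ 0 := by linarith
  have hne2 : (p : ℝ) ≠ 0 := by
    have : (0 : ℝ) ≤ N := by rw [hN]; positivity
    linarith
  have h1 : ∀ t t', (n t' : ℝ) / (T * p) * (1 + T * n t / (2 * (p - N - 1)))
          * ‖wstar t - wstar t'‖ ^ 2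
      = 1 / (T * p) * (‖wstar t‖ ^ 2 * n t') + 1 / (T * p) * (1 * (n t' * ‖wstar t'‖ ^ 2))
        + 1 / (2 * p * (p - N - 1)) * (n t * ‖wstar t‖ ^ 2 * n t')
        + 1 / (2 * p * (p - N - 1)) * (n t * (n t' * ‖wstar t'‖ ^ 2))
        - 2 * ((n t' : ℝ) / (T * p) * (1 + T * n t / (2 * (p - N - 1)))
          * inner ℝ (wstar t) (wstar t')) := fun t t' => by
    rw [norm_sub_sq_real]
    field_simp
    ring
  have h2 : ∀ t, (1 - (n t : ℝ) / p) * ‖wstar t‖ ^ 2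
      = ‖wstar t‖ ^ 2 - 1 / p * (n t * ‖wstar t‖ ^ 2) := fun t => by ring
  have h3 : ∀ t, (n t : ℝ) / p * ‖wstar t‖ ^ 2 = 1 / p * (n t * ‖wstar t‖ ^ 2) := fun t => by ring
  simp only [h1, h2, h3, Finset.sum_sub_distrib, Finset.sum_add_distrib, ← Finset.mul_sum,
    ← Finset.sum_mul, ← hN, Finset.sum_const, Finset.card_univ, Fintype.card_fin, nsmul_eq_mul]
  field_simp
  ring

end Tasks

end MultiTask

theorem theorem2 {Ω : Type*} [MeasurableSpace Ω] (μ : Measure Ω) [IsProbabilityMeasure μ]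
    (T p : ℕ) (hT : 0 < T) (n : Fin T → ℕ) (nbar : ℕ) (hnbar : nbar = ∑ t, n t)
    (hp : nbar + 2 ≤ p) (σ : ℝ) (wstar : Fin T → MultiTask.Param p)
    (x : MultiTask.SampleIdx n → Ω → MultiTask.Param p) (z : MultiTask.SampleIdx n → Ω → ℝ)
    (hdata : MultiTask.IsGaussianData μ σ x z) :
    -- almost surely, the optimization problems that define the learners have a unique solution
    (∀ᵐ ω ∂μ, ∃! w, MultiTask.IsMinNormInterpolator (fun s => x s ω)
      (MultiTask.labels wstar (fun s => x s ω) (fun s => z s ω)) w) ∧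
    (∀ t, ∀ᵐ ω ∂μ, ∃! w, MultiTask.IsMinNormInterpolator (fun i : Fin (n t) => x ⟨t, i⟩ ω)
      (fun i => MultiTask.labels wstar (fun s => x s ω) (fun s => z s ω) ⟨t, i⟩) w) ∧
    -- generalization error
    Integrable (fun ω => MultiTask.avgGenError wstar (fun s => x s ω) (fun s => z s ω)) μ ∧
    ∫ ω, MultiTask.avgGenError wstar (fun s => x s ω) (fun s => z s ω) ∂μ =
      (∑ t, ∑ t', (n t' : ℝ) / (T * p) * (1 + T * n t / (2 * (p - nbar - 1)))
          * ‖wstar t - wstar t'‖ ^ 2)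
        + 1 / (T : ℝ) * (1 - (nbar : ℝ) / p) * ∑ t, ‖wstar t‖ ^ 2
        + nbar * σ ^ 2 / ((p : ℝ) - nbar - 1) ∧
    -- knowledge transfer
    Integrable (fun ω => MultiTask.avgTransfer wstar (fun s => x s ω) (fun s => z s ω)) μ ∧
    ∫ ω, MultiTask.avgTransfer wstar (fun s => x s ω) (fun s => z s ω) ∂μ =
      2 * (∑ t, ∑ t', (n t' : ℝ) / (T * p) * (1 + T * n t / (2 * (p - nbar - 1)))
          * inner ℝ (wstar t) (wstar t'))
        - (1 + 1 / (T : ℝ) + nbar / ((p : ℝ) - nbar - 1)) * (∑ t, (n t : ℝ) / p * ‖wstar t‖ ^ 2)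
        - nbar * σ ^ 2 / ((p : ℝ) - nbar - 1)
        + 1 / (T : ℝ) * ∑ t, n t * σ ^ 2 / ((p : ℝ) - n t - 1) := by
  subst hnbar
  have hnt : ∀ t, n t + 2 ≤ p := fun t =>
    (Nat.add_le_add_right (Finset.single_le_sum (fun i _ => Nat.zero_le (n i))
      (Finset.mem_univ t)) 2).trans hp
  obtain ⟨hGi, hG⟩ := hdata.integral_avgGenError hT hp wstar
  have hs := fun t => hdata.integral_taskLoss_singleTaskLearner wstar t (hnt t)
  have hm := fun t => hdata.integral_taskLoss_multiTaskLearner hp wstar t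
  have hsi := (integrable_finsetSum Finset.univ fun t _ => (hs t).1).const_mul (1 / (T : ℝ))
  -- The transfer is the mean single-task loss minus the error already computed, so only single-task
  -- expectations remain.
  have hK : ∀ ω, MultiTask.avgTransfer wstar (fun s => x s ω) (fun s => z s ω)
      = 1 / (T : ℝ) * (∑ t, MultiTask.taskLoss wstar t
          (MultiTask.singleTaskLearner wstar (fun s => x s ω) (fun s => z s ω) t))
        - MultiTask.avgGenError wstar (fun s => x s ω) (fun s => z s ω) := fun ω => by
    simp only [MultiTask.avgTransfer, MultiTask.avgGenError]
    rw [Finset.sum_sub_distrib, mul_sub]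
  refine ⟨?_, fun t => ?_, hGi, hG, ?_, ?_⟩
  · filter_upwards [hdata.ae_linearIndependent (by rwa [MultiTask.card_sampleIdx])] with ω hω
    exact MultiTask.existsUnique_isMinNormInterpolator hω _
  · have hdata' := hdata.comp_injective (f := fun i : Fin (n t) => (⟨t, i⟩ : MultiTask.SampleIdx n))
      (sigma_mk_injective (β := fun t => Fin (n t)))
    filter_upwards [hdata'.ae_linearIndependent (by rw [Fintype.card_fin]; exact hnt t)] with ω hω
    exact MultiTask.existsUnique_isMinNormInterpolator hω _
  · simp only [hK]
    exact hsi.sub hGi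
  · simp only [hK]
    rw [integral_sub hsi hGi, hG, integral_const_mul, integral_finsetSum _ fun t _ => (hs t).1]
    simp only [(hs _).2, Finset.sum_add_distrib]
    have h := MultiTask.transfer_identity wstar n hT hp
    linarith
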